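/- Let $g:\mathbf R^d\to\mathbf R\cup\{+\infty\}$ be proper, closed and convex, let $h:\mathbf R^m\to\mathbf R$ be convex and $L$-Lipschitz, and let $c:\mathbf R^d\to\mathbf R^m$ be $C^1$ with $\beta$-Lipschitz Jacobian $\nabla c$ (in operator norm). Put $F(x)=g(x)+h(c(x))$ and $\mu=L\beta$. For $t>0$ put $$F_t(z;x)=g(z)+h\big(c(x)+\nabla c(x)(z-x)\big)+\tfrac1{2t}\|z-x\|^2,\qquad S_t(x)=\operatorname{argmin}_z F_t(z;x),\qquad \mathcal G_t(x)=t^{-1}(x-S_t(x)).$$ Fix $x_0\in\operatorname{dom} g$ and $\varepsilon>0$, and suppose $\Delta:=F(x_0)-\inf F<\infty$. Basic operations are the evaluations of $c(x)$, of $\nabla c(x)v$, of $\nabla c(x)^*w$, of $\mathrm{prox}_{sg}$ and of $\mathrm{prox}_{sh}$ ($s>0$). Replace $h$ by its Moreau envelope $h_\nu(y)=\inf_z\{h(z)+\frac1{2\nu}\|z-y\|^2\}$ with $\nu=\varepsilon^2/(2L^3\beta)$, put $F^\nu=g+h_\nu\circ c$, write $F^\nu_t$ and $S^\nu_t$ for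 the corresponding objects, and let $t=1/\mu$. Let $\|\nabla c\|$ denote a real number with $\|\nabla c\|\ge\|\nabla c(x_k)\|_{\rm op}$ for all iterates $x_k$ below (for instance $\|\nabla c\|\ge\sup_{x\in\operatorname{dom}g}\|\nabla c(x)\|_{\rm op}$), and let $M_k>0$ be any numbers with $\|\nabla c(x_k)\|_{\rm op}\le M_k\le\|\nabla c\|$; they are used to form the Lipschitz constants in step $k$. Nesterov's fast-gradient method for $\min f+p$, where $\nabla f$ is $L_f$-Lipschitz and $p$ is $\alpha$-strongly convex, starts at $z_0=v_0$ with $\theta_0=0$. In iteration $j$ it takes $a>0$ with $a^2/(\theta_j+a)=2(1+\alpha\theta_j)/L_f$, sets $\theta_{j+1}=\theta_j+a$, $y_j=(\theta_jz_j+a v_j)/\theta_{j+1}$ and $z_{j+1}=\mathrm{prox}_{p/L_f}(y_j-\nabla f(y_j)/L_f)$, and lets $v_{j+1}$ be the minimizer of $\frac12\|z-z_0\|^2+\sum_{i\le j+1}a_i\big[f(z_i)+\langle\nabla f(z_i),z-z_i\rangle+p(z)\big]$, where $a_i=\theta_i-\theta_{i-1}$. Put $\sigma=\sqrt{\alpha/(2L_f)}$.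 Consider the following two methods, implemented with basic operations. * Dual subsolves. In step $k\ge0$, with $\varepsilon_{k+1}=\frac1{L(k+1)^2}$, run the fast-gradient method on the dual problem $\min_w f(w)+h_\nu^\star(w)$, $f(w)=\big(g+\frac1{2t}\|\cdot-x_k\|^2\big)^\star(-\nabla c(x_k)^*w)-\langle c(x_k)-\nabla c(x_k)x_k,w\rangle$, from any point of $\operatorname{dom}h_\nu^\star$, with $L_f=tM_k^2$ and $\alpha=\nu$, for $1+\max\{0,\lceil\log(8L_f^2L^2/\varepsilon_{k+1}^2)/(2\log(1+\sigma))\rceil\}$ iterations. Then take one more prox-gradient step, which gives $w_{k+1}$, and set $x_{k+1}=\mathrm{prox}_{tg}(x_k-t\nabla c(x_k)^*w_{k+1})$. * Primal subsolves. In step $k\ge0$, run the fast-gradient method on $\min_zF^\nu_t(z;x_k)$, split into $f(z)=h_\nu(c(x_k)+\nabla c(x_k)(z-x_k))$ and $p(z)=g(z)+\frac1{2t}\|z-x_k\|^2$, from $x_k$, with $L_f=M_k^2/\nu$ and $\alpha=\mu$, for $\max\{1,\lceil\tau^{-1}\log(4t\gamma)\rceil\}$ iterations, where $\tau=1-(1+\sigma)^{-2}$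 and $\gamma=(1+\sigma)^2L_f/4$. Let $x_{k+1}$ be the last iterate. Then there are absolute constants $K,C>0$ such that the following holds whenever $\|\nabla c\|,\,L,\,\beta,\,\Delta,\,1/\varepsilon\ge K$. 1. The dual method is an inexact prox-linear method on $F^\nu$: for every $k$ there is $\zeta$ with $\|\zeta\|\le\varepsilon_{k+1}$ such that $x_{k+1}$ minimizes $z\mapsto g(z)+h_\nu(\zeta+c(x_k)+\nabla c(x_k)(z-x_k))+\frac1{2t}\|z-x_k\|^2$. It finds an iterate $x$ with $\|\mathcal G_{1/\mu}(x)\|\le\varepsilon$ after at most $$C\cdot\frac{L^2\beta\|\nabla c\|\,(F(x_0)-\inf F)}{\varepsilon^3}\,\log\!\left(\frac{\|\nabla c\|^2L^3\beta\,(F(x_0)-\inf F)^2}{\varepsilon^4}\right)$$ basic operations. 2. The primal method is an inexact prox-linear method on $F^\nu$: for every $k$, $F^\nu_t(x_{k+1};x_k)\le\inf F^\nu_t(\cdot;x_k)+\frac1{4t}\|x_k-S^\nu_t(x_k)\|^2$. It finds an iterate $x$ with $\|\mathcal G_{1/\mu}(x)\|\le\varepsilon$ after at most $$C\cdot\frac{L^2\beta\|\nabla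 c\|\,(F(x_0)-\inf F)}{\varepsilon^3}\,\log\!\left(\frac{\|\nabla c\|L}{\varepsilon}\right)$$ basic operations. -/

import Mathlib

/-! ### Extended-real-valued convex analysis -/

/-- A minimizer of an extended-real-valued function (an arbitrary point if there is none). -/
noncomputable def argmin {X : Type} [Nonempty X] (f : X → EReal) : X :=
  Classical.epsilon fun z => ∀ y, f z ≤ f y

/-- `g : X → ℝ ∪ {±∞}` is proper, closed and convex: the domain is nonempty, the value `-∞` is not
taken, and the epigraph is closed and convex. -/
structure ProperClosedConvex {X : Type} [NormedAddCommGroup X] [NormedSpace ℝ X]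
    (g : X → EReal) : Prop where
  dom_nonempty : ∃ x, g x < ⊤
  ne_bot : ∀ x, g x ≠ ⊥
  closed_epi : IsClosed {q : X × ℝ | g q.1 ≤ (q.2 : EReal)}
  convex_epi : Convex ℝ {q : X × ℝ | g q.1 ≤ (q.2 : EReal)}

/-- The proximal map `prox_{t f}(x) = argmin_z { f(z) + ‖z - x‖² / (2t) }`. -/
noncomputable def prox {X : Type} [NormedAddCommGroup X] (t : ℝ) (f : X → EReal) (x : X) : X :=
  argmin fun z => f z + ((‖z - x‖ ^ 2 / (2 * t) : ℝ) : EReal)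

/-- The Moreau envelope `h_ν(y) = inf_z { h(z) + ‖z - y‖² / (2ν) }` of a real-valued function. -/
noncomputable def moreau {X : Type} [NormedAddCommGroup X] (ν : ℝ) (h : X → ℝ) (y : X) : ℝ :=
  ⨅ z, (h z + ‖z - y‖ ^ 2 / (2 * ν))

/-- The Fenchel conjugate of a real-valued function. -/
noncomputable def fenchelConj {X : Type} [NormedAddCommGroup X] [InnerProductSpace ℝ X]
    (h : X → ℝ) (w : X) : EReal :=
  ⨆ y, ((inner ℝ w y - h y : ℝ) : EReal)

/-! ### The composite problem class -/

/-- The data of a composite problem `min_x F(x) = g(x) + h(c(x))`. -/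
structure CompositeProblem (E Y : Type) where
  g : E → EReal
  h : Y → ℝ
  c : E → Y

namespace CompositeProblem

section

variable {E Y : Type} [NormedAddCommGroup E] [InnerProductSpace ℝ E]
  [NormedAddCommGroup Y] [InnerProductSpace ℝ Y]

/-- The standing assumptions: `g` is proper, closed and convex, `h` is convex and `L`-Lipschitz, and
`c` is `C¹` with a `β`-Lipschitz Jacobian. -/
structure Standing (P : CompositeProblem E Y) (L β : ℝ) : Prop where
  g_pcc : ProperClosedConvex P.g
  h_convex : ConvexOn ℝ Set.univ P.h
  h_lipschitz : ∀ y z, |P.h y - P.h z| ≤ L * ‖y - z‖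
  c_contDiff : ContDiff ℝ 1 P.c
  jac_lipschitz : ∀ x y, ‖fderiv ℝ P.c x - fderiv ℝ P.c y‖ ≤ β * ‖x - y‖

/-- The objective `F(x) = g(x) + h(c(x))`. -/
noncomputable def F (P : CompositeProblem E Y) (x : E) : EReal :=
  P.g x + (P.h (P.c x) : EReal)

/-- The prox-linear subproblem with the argument of `h` shifted by `ζ`:
`z ↦ g(z) + h(ζ + c(x) + ∇c(x)(z - x)) + ‖z - x‖² / (2t)`. -/
noncomputable def shiftedModel (P : CompositeProblem E Y) (t : ℝ) (ζ : Y) (x z : E) : EReal :=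
  P.g z + ((P.h (ζ + P.c x + fderiv ℝ P.c x (z - x)) + ‖z - x‖ ^ 2 / (2 * t) : ℝ) : EReal)

/-- The prox-linear subproblem
`F_t(z; x) = g(z) + h(c(x) + ∇c(x)(z - x)) + ‖z - x‖² / (2t)`. -/
noncomputable def model (P : CompositeProblem E Y) (t : ℝ) (x z : E) : EReal :=
  P.g z + ((P.h (P.c x + fderiv ℝ P.c x (z - x)) + ‖z - x‖ ^ 2 / (2 * t) : ℝ) : EReal)

/-- The exact prox-linear step `S_t(x) = argmin_z F_t(z; x)`. -/
noncomputable def proxLinear (P : CompositeProblem E Y) (t : ℝ) (x : E) : E :=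
  argmin (P.model t x)

/-- The prox-gradient `G_t(x) = t⁻¹ (x - S_t(x))`. -/
noncomputable def proxGrad (P : CompositeProblem E Y) (t : ℝ) (x : E) : E :=
  t⁻¹ • (x - P.proxLinear t x)

/-- The smoothed problem `min_x F^ν(x) = g(x) + h_ν(c(x))`. -/
noncomputable def smooth (P : CompositeProblem E Y) (ν : ℝ) : CompositeProblem E Y where
  g := P.g
  h := moreau ν P.h
  c := P.c

/-- `xp` is a step from `x` of the inexact prox-linear method with near-stationarity `η`: it is the
exact minimizer of the subproblem shifted by some `ζ` with `‖ζ‖ ≤ η`. -/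
def NearStationaryStep (P : CompositeProblem E Y) (t η : ℝ) (x xp : E) : Prop :=
  ∃ ζ : Y, ‖ζ‖ ≤ η ∧ ∀ z, P.shiftedModel t ζ x xp ≤ P.shiftedModel t ζ x z

/-- `xp` is a step from `x` of the inexact prox-linear method with near-optimality `η`: it is an
`η`-approximate minimizer of `F_t(·; x)`. -/
def NearOptimalStep (P : CompositeProblem E Y) (t η : ℝ) (x xp : E) : Prop :=
  ∀ z, P.model t x xp ≤ P.model t x z + (η : EReal)

end

end CompositeProblem

/-! ### Oracle programs and their number of basic operations -/

/-- A program with results in `α` that reaches the data `g, h, c` of a composite problem only through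
the basic operations: evaluation of `c(x)`, the products `∇c(x) v` and `∇c(x)* w`, and evaluation of
`prox_{t g}` and `prox_{t h}`. Each constructor except `ret` issues one basic operation and continues
with its answer. -/
inductive Prog (E Y α : Type) : Type where
  | ret (a : α)
  | evalC (x : E) (k : Y → Prog E Y α)
  | jac (x v : E) (k : Y → Prog E Y α)
  | jacAdj (x : E) (w : Y) (k : E → Prog E Y α)
  | proxG (t : ℝ) (x : E) (k : E → Prog E Y α)
  | proxH (t : ℝ) (y : Y) (k : Y → Prog E Y α)

namespace Prog

/-- Sequential composition. -/
def seq {E Y α γ : Type} (p : Prog E Y α) (f : α → Prog E Y γ) : Prog E Y γ :=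
  match p with
  | ret a => f a
  | evalC x k => evalC x fun r => (k r).seq f
  | jac x v k => jac x v fun r => (k r).seq f
  | jacAdj x w k => jacAdj x w fun r => (k r).seq f
  | proxG t x k => proxG t x fun r => (k r).seq f
  | proxH t y k => proxH t y fun r => (k r).seq f

instance {E Y : Type} : Monad (Prog E Y) where
  pure := ret
  bind := seq

section

variable {E Y : Type} [NormedAddCommGroup E] [InnerProductSpace ℝ E] [CompleteSpace E]
  [NormedAddCommGroup Y] [InnerProductSpace ℝ Y] [CompleteSpace Y]

/-- Running a program on a composite problem: the result, and the number of basic operations. -/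
noncomputable def run {α : Type} (P : CompositeProblem E Y) : Prog E Y α → α × ℕ
  | ret a => (a, 0)
  | evalC x k => ((run P (k (P.c x))).1, (run P (k (P.c x))).2 + 1)
  | jac x v k => ((run P (k (fderiv ℝ P.c x v))).1, (run P (k (fderiv ℝ P.c x v))).2 + 1)
  | jacAdj x w k =>
      let r := ContinuousLinearMap.adjoint (fderiv ℝ P.c x) w
      ((run P (k r)).1, (run P (k r)).2 + 1)
  | proxG t x k => ((run P (k (prox t P.g x))).1, (run P (k (prox t P.g x))).2 + 1)
  | proxH t y k =>
      let r := prox t (fun z => (P.h z : EReal)) y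
      ((run P (k r)).1, (run P (k r)).2 + 1)

end

/-- The operation `c(x)`. -/
def askC {E Y : Type} (x : E) : Prog E Y Y := evalC x ret

/-- The operation `∇c(x) v`. -/
def askJac {E Y : Type} (x v : E) : Prog E Y Y := jac x v ret

/-- The operation `∇c(x)* w`. -/
def askJacAdj {E Y : Type} (x : E) (w : Y) : Prog E Y E := jacAdj x w ret

/-- The operation `prox_{t g}(x)`. -/
def askProxG {E Y : Type} (t : ℝ) (x : E) : Prog E Y E := proxG t x ret

/-- The operation `prox_{t h}(y)`. -/
def askProxH {E Y : Type} (t : ℝ) (y : Y) : Prog E Y Y := proxH t y ret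

end Prog

/-! ### Nesterov's fast-gradient method for `min f + p` -/

/-- The state after `j` iterations: the weight `θ_j`, the iterate `x_j`, the minimizer `v_j` of the
estimating function `ψ_j`, and `S_j = ∑_{i ≤ j} a_i ∇f(x_i)`. -/
structure FGState (X : Type) where
  θ : ℝ
  x : X
  v : X
  S : X

/-- One iteration of the fast-gradient method, started at `z₀`, for `min f + p`, where `∇f` is
`Lf`-Lipschitz and computed by `grad`, and `p` is `α`-strongly convex with `prox_{τ p}` computed by
`proxp τ`. The number `a` is the positive root of `a² / (θ + a) = 2 (1 + α θ) / Lf`. Up to a constant,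
`ψ_j(x) = ‖x - z₀‖² / 2 + ⟨S_j, x⟩ + θ_j p(x)`, hence `argmin ψ_j = prox_{θ_j p}(z₀ - S_j)`. -/
noncomputable def fgStep {E Y X : Type} [AddCommGroup X] [Module ℝ X]
    (grad : X → Prog E Y X) (proxp : ℝ → X → Prog E Y X) (α Lf : ℝ) (z₀ : X) (s : FGState X) :
    Prog E Y (FGState X) := do
  let κ := 2 * (1 + α * s.θ) / Lf
  let a := (κ + √(κ ^ 2 + 4 * κ * s.θ)) / 2
  let θ := s.θ + a
  let y := θ⁻¹ • (s.θ • s.x + a • s.v)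
  let gy ← grad y
  let x ← proxp Lf⁻¹ (y - Lf⁻¹ • gy)
  let gx ← grad x
  let S := s.S + a • gx
  let v ← proxp θ (z₀ - S)
  pure { θ := θ, x := x, v := v, S := S }

/-- `T` iterations of the fast-gradient method from `z₀`. -/
noncomputable def fastGradient {E Y X : Type} [AddCommGroup X] [Module ℝ X]
    (grad : X → Prog E Y X) (proxp : ℝ → X → Prog E Y X) (α Lf : ℝ) (z₀ : X) :
    ℕ → Prog E Y (FGState X)
  | 0 => pure { θ := 0, x := z₀, v := z₀, S := 0 }
  | T + 1 => do
      let s ← fastGradient grad proxp α Lf z₀ T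
      fgStep grad proxp α Lf z₀ s

/-! ### The smoothing strategy with dual subsolves -/

section

variable {E Y : Type} [NormedAddCommGroup E] [InnerProductSpace ℝ E]
  [NormedAddCommGroup Y] [InnerProductSpace ℝ Y]

/-- The Fenchel dual of the subproblem `min_z F^ν_t(z; x)` is `min_w f(w) + (h_ν)*(w)`, where
`f(w) = (g + ‖· - x‖² / (2t))*(-∇c(x)* w) - ⟨c(x) - ∇c(x) x, w⟩`. This computes
`∇f(w) = ∇c(x) (x - prox_{t g}(x - t ∇c(x)* w)) - c(x)`, given `cx = c(x)`. -/
noncomputable def dualGrad (t : ℝ) (x : E) (cx : Y) (w : Y) : Prog E Y Y := do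
  let u ← Prog.askJacAdj x w
  let z ← Prog.askProxG t (x - t • u)
  let r ← Prog.askJac x (x - z)
  pure (r - cx)

/-- Computes `prox_{s h_ν}(y) = ν/(s+ν) y + s/(s+ν) prox_{(s+ν) h}(y)`. -/
noncomputable def envProx (ν s : ℝ) (y : Y) : Prog E Y Y := do
  let q ← Prog.askProxH (s + ν) y
  pure ((ν / (s + ν)) • y + (s / (s + ν)) • q)

/-- Computes `prox_{τ (h_ν)*}(w) = w - τ prox_{h_ν/τ}(w/τ)`. -/
noncomputable def dualProx (ν τ : ℝ) (w : Y) : Prog E Y Y := do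
  let q ← envProx ν τ⁻¹ (τ⁻¹ • w)
  pure (w - τ • q)

/-- The number of fast-gradient iterations on the dual. With `σ = √(α / (2 Lf))`, after `j ≥ 1`
iterations the gap is at most `(1 + σ)^(-2(j-1)) (Lf / 4) dist²`, and `dist ≤ 2 L`; this is the number
of iterations after which this bound is at most `η² / (8 Lf)`, so that a further prox-gradient step
gives a subgradient of norm at most `η`. -/
noncomputable def dualCount (L α Lf η : ℝ) : ℕ :=
  1 + ⌈Real.log (8 * Lf ^ 2 * L ^ 2 / η ^ 2) / (2 * Real.log (1 + √(α / (2 * Lf))))⌉₊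

/-- One outer step from `x` with dual subsolves: apply the fast-gradient method from `w₀` to the dual
of `min_z F^ν_t(z; x)`, take one more prox-gradient step on the dual, which gives `w`, and recover
`prox_{t g}(x - t ∇c(x)* w)`. Here `η` is the tolerance and `M` an upper bound on `‖∇c(x)‖`; the smooth
part has a `t M²`-Lipschitz gradient and `(h_ν)*` is `ν`-strongly convex. -/
noncomputable def dualStep (L t ν η M : ℝ) (w₀ : Y) (x : E) : Prog E Y E := do
  let cx ← Prog.askC x
  let Lf := t * M ^ 2
  let s ← fastGradient (dualGrad t x cx) (dualProx ν) ν Lf w₀ (dualCount L ν Lf η)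
  let gw ← dualGrad t x cx s.x
  let w ← dualProx ν Lf⁻¹ (s.x - Lf⁻¹ • gw)
  let u ← Prog.askJacAdj x w
  Prog.askProxG t (x - t • u)

/-- The smoothing parameter `ν = ε² / (2 L³ β)`. -/
noncomputable def smoothingParam (L β ε : ℝ) : ℝ := ε ^ 2 / (2 * L ^ 3 * β)

/-- The tolerance `ε_k = 1 / (L k²)`. -/
noncomputable def dualTol (L : ℝ) (k : ℕ) : ℝ := 1 / (L * (k : ℝ) ^ 2)

/-- The program that computes the `k`-th iterate `x_k` of the smoothing strategy with dual subsolves,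
with `t = 1 / (L β)`, `ν = ε² / (2 L³ β)` and tolerances `ε_k = 1 / (L k²)`. The `k`-th subproblem uses
the bound `M k` on `‖∇c(x_k)‖` and the dual starting point `w₀ k`. -/
noncomputable def dualMethod (L β ε : ℝ) (M : ℕ → ℝ) (w₀ : ℕ → Y) (x₀ : E) : ℕ → Prog E Y E
  | 0 => pure x₀
  | k + 1 => do
      let x ← dualMethod L β ε M w₀ x₀ k
      dualStep L (L * β)⁻¹ (smoothingParam L β ε) (dualTol L (k + 1)) (M k) (w₀ k) x

/-! ### The smoothing strategy with primal subsolves -/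

/-- The smooth part of `F^ν_t(·; x)` is `f(z) = h_ν(c(x) + ∇c(x)(z - x))`. This computes
`∇f(z) = ∇c(x)* ν⁻¹ (y - prox_{ν h}(y))` with `y = c(x) + ∇c(x)(z - x)`, given `cx = c(x)`. -/
noncomputable def primalGrad (ν : ℝ) (x : E) (cx : Y) (z : E) : Prog E Y E := do
  let r ← Prog.askJac x (z - x)
  let q ← Prog.askProxH ν (cx + r)
  Prog.askJacAdj x (ν⁻¹ • (cx + r - q))

/-- Computes `prox_{τ p}(u)` for the strongly convex part `p = g + ‖· - x‖² / (2t)` of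
`F^ν_t(·; x)`. -/
noncomputable def primalProx (t : ℝ) (x : E) (τ : ℝ) (u : E) : Prog E Y E :=
  Prog.askProxG (t * τ / (t + τ)) ((t + τ)⁻¹ • (τ • x + t • u))

/-- The number `⌈τ⁻¹ log (4 t γ)⌉` (and at least one) of fast-gradient iterations on the primal, where
`τ = 1 - (1 + σ)⁻²` and `γ = (1 + σ)² Lf / 4` with `σ = √(α / (2 Lf))`, so that
`γ (1 - τ)^j = (1 + σ)^(-2(j-1)) Lf / 4` is the rate of the fast-gradient method. -/
noncomputable def primalCount (t α Lf : ℝ) : ℕ :=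
  let σ := √(α / (2 * Lf))
  max 1 ⌈(1 - ((1 + σ) ^ 2)⁻¹)⁻¹ * Real.log (4 * t * ((1 + σ) ^ 2 * (Lf / 4)))⌉₊

/-- One outer step from `x` with primal subsolves: apply the fast-gradient method from `x` to
`min_z F^ν_t(z; x)`. Here `M` is an upper bound on `‖∇c(x)‖`; the smooth part has an
`M² / ν`-Lipschitz gradient and the rest is `1/t`-strongly convex. -/
noncomputable def primalStep (t ν M : ℝ) (x : E) : Prog E Y E := do
  let cx ← Prog.askC (Y := Y) x
  let Lf := M ^ 2 / ν
  let s ← fastGradient (primalGrad ν x cx) (primalProx t x) t⁻¹ Lf x (primalCount t t⁻¹ Lf)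
  pure s.x

/-- The program that computes the `k`-th iterate `x_k` of the smoothing strategy with primal subsolves,
with `t = 1 / (L β)` and `ν = ε² / (2 L³ β)`. The `k`-th subproblem uses the bound `M k` on
`‖∇c(x_k)‖`. -/
noncomputable def primalMethod (Y : Type) [NormedAddCommGroup Y] [InnerProductSpace ℝ Y]
    (L β ε : ℝ) (M : ℕ → ℝ) (x₀ : E) : ℕ → Prog E Y E
  | 0 => pure x₀
  | k + 1 => do
      let x ← primalMethod Y L β ε M x₀ k
      primalStep (L * β)⁻¹ (smoothingParam L β ε) (M k) x

end

/-! ### Minimizers of strongly convex extended-real-valued functions -/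

section Minimizers

variable {X : Type} [NormedAddCommGroup X] [InnerProductSpace ℝ X]

/-! The argument has an outer and an inner half, linked by the choice of `ν`.

Outer half. Smoothing changes `h` by at most `L²ν/2 = ε²/(4μ)`, with `μ = Lβ`. The models of `F` and
of `F^ν` are `μ`-strongly convex, so their minimizers differ by at most `ε/(2μ)` and the two
prox-gradients by at most `ε/2` (`Standing.norm_proxLinear_sub_smooth_sq_le`). Since `t = 1/μ`,
Taylor's estimate makes the model a majorant of the objective. Hence a step that is optimal up to
`e` lowers `F^ν` by `μ/2 ‖x - S^ν(x)‖² - e` (`Standing.descent`). For dual steps `e = 2/(k+1)²` is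
summable; for primal steps `e` is half of the decrease. As long as every prox-gradient of `F`
exceeds `ε`, each step therefore gains `ε²/(16μ)` up to summable errors, which is impossible for
`32μΔ/ε²` steps (`Standing.exists_norm_proxGrad_le`).

Inner half. The fast-gradient method keeps an estimating function whose minimum bounds `θ_j (f +
p)(z_j)` from above (`FGInvariant.next`). Its weights satisfy `θ_1 = 2/L_f` and grow by the factor
`(1 + σ)²`, which gives a linear rate against any point of the domain (`fastGradient_rate`). In the
primal subsolve the comparison point is the exact step, so the error is a multiple of `‖x -
S^ν(x)‖²`, as required. In the dual subsolve the domain of `h_ν*` lies in the ball of radius `L`. A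
small gap and one more prox-gradient step then give a dual subgradient of norm at most `η`, and this
subgradient is the shift `ζ` of the primal subproblem (`shiftedModel_recovered_le`).

In both cases `σ = ε/(2L M_k)`, so a subsolve takes `O(‖∇c‖L/ε)` iterations times a logarithm, at
eight basic operations each. Multiplying by the number of outer steps gives the bounds. -/

theorem argmin_spec {X : Type} [Nonempty X] {f : X → EReal} (hf : ∃ z, ∀ y, f z ≤ f y) (y : X) :
    f (argmin f) ≤ f y :=
  Classical.epsilon_spec (p := fun z => ∀ y, f z ≤ f y) hf y

namespace ProperClosedConvex

variable {g : X → EReal}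

theorem coe_toReal (hg : ProperClosedConvex g) {x : X} (hx : g x < ⊤) :
    ((g x).toReal : EReal) = g x :=
  EReal.coe_toReal hx.ne (hg.ne_bot x)

theorem convexOn_toReal (hg : ProperClosedConvex g) :
    ConvexOn ℝ {x | g x < ⊤} fun x => (g x).toReal := by
  have key : ∀ ⦃x⦄, g x < ⊤ → ∀ ⦃y⦄, g y < ⊤ → ∀ ⦃a b : ℝ⦄, 0 ≤ a → 0 ≤ b → a + b = 1 →
      g (a • x + b • y) ≤ ((a * (g x).toReal + b * (g y).toReal : ℝ) : EReal) := by
    intro x hx y hy a b ha hb hab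
    have h1 : ((x, (g x).toReal) : X × ℝ) ∈ {q : X × ℝ | g q.1 ≤ (q.2 : EReal)} := by
      simp [hg.coe_toReal hx]
    have h2 : ((y, (g y).toReal) : X × ℝ) ∈ {q : X × ℝ | g q.1 ≤ (q.2 : EReal)} := by
      simp [hg.coe_toReal hy]
    simpa using hg.convex_epi h1 h2 ha hb hab
  refine ⟨fun x hx y hy a b ha hb hab => (key hx hy ha hb hab).trans_lt (EReal.coe_lt_top _), ?_⟩
  intro x hx y hy a b ha hb hab
  have h := key hx hy ha hb hab
  rw [← hg.coe_toReal (h.trans_lt (EReal.coe_lt_top _))] at h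
  simpa using EReal.coe_le_coe_iff.1 h

/-- Sublevel sets are preimages of the closed epigraph under the continuous map `z ↦ (z, r - q z)`.
-/
theorem lowerSemicontinuous_add (hg : ProperClosedConvex g) {q : X → ℝ} (hq : Continuous q) :
    LowerSemicontinuous fun z => g z + (q z : EReal) := by
  rw [lowerSemicontinuous_iff_isClosed_preimage]
  have hreal : ∀ r : ℝ, IsClosed {z | g z + (q z : EReal) ≤ (r : EReal)} := by
    intro r
    have : {z | g z + (q z : EReal) ≤ (r : EReal)} =
        (fun z => (z, r - q z)) ⁻¹' {q : X × ℝ | g q.1 ≤ (q.2 : EReal)} := by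
      ext z
      simp only [Set.mem_ofPred_eq, Set.mem_preimage, EReal.coe_sub]
      exact (EReal.le_sub_iff_add_le (Or.inl (EReal.coe_ne_bot _))
        (Or.inl (EReal.coe_ne_top _))).symm
    rw [this]
    exact hg.closed_epi.preimage (by fun_prop)
  intro y
  induction y with
  | bot =>
    have : (fun z => g z + (q z : EReal)) ⁻¹' Set.Iic ⊥ = ∅ := by
      ext z
      simp [EReal.add_eq_bot_iff, hg.ne_bot z]
    rw [this]
    exact isClosed_empty
  | coe r => exact hreal r
  | top => simp

theorem toReal_add_le_iff (hg : ProperClosedConvex g) {x y : X} (hx : g x < ⊤) (hy : g y < ⊤)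
    (a b : ℝ) : g x + (a : EReal) ≤ g y + (b : EReal) ↔ (g x).toReal + a ≤ (g y).toReal + b := by
  rw [← hg.coe_toReal hx, ← hg.coe_toReal hy]
  norm_cast

theorem strongConvex_add (hg : ProperClosedConvex g) {q : X → ℝ} {α : ℝ}
    (hsc : StrongConvexOn Set.univ α q) :
    StrongConvexOn {x | g x < ⊤} α fun x => (g x).toReal + q x := by
  refine ⟨hg.convexOn_toReal.1, fun x hx y hy a b ha hb hab => ?_⟩
  have h1 := hg.convexOn_toReal.2 hx hy ha hb hab
  have h2 := hsc.2 (Set.mem_univ x) (Set.mem_univ y) ha hb hab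
  simp only [smul_eq_mul] at h1 h2 ⊢
  linarith

/-- Compactness provides minimizers on balls only, and no global lower bound is given. The minimum
`m` over the unit ball about `x₀` supplies one: if `y` is far away, the point of the segment from
`x₀` to `y` at distance 1 has value at least `m`, and strong convexity then forces the value at `y`
above that at `x₀`. -/
theorem exists_minimizer [ProperSpace X] (hg : ProperClosedConvex g) {q : X → ℝ}
    (hq : Continuous q) {α : ℝ} (hα : 0 < α) (hsc : StrongConvexOn Set.univ α q) :
    ∃ z, ∀ y, g z + (q z : EReal) ≤ g y + (q y : EReal) := by
  obtain ⟨x₀, hx₀⟩ := hg.dom_nonempty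
  have hlsc := hg.lowerSemicontinuous_add hq
  have hmin : ∀ R : ℝ, 0 ≤ R → ∃ z ∈ Metric.closedBall x₀ R, ∀ y ∈ Metric.closedBall x₀ R,
      g z + (q z : EReal) ≤ g y + (q y : EReal) := fun R hR =>
    (hlsc.lowerSemicontinuousOn _).exists_isMinOn ⟨x₀, Metric.mem_closedBall_self hR⟩
      (isCompact_closedBall x₀ R)
  have hfin : ∀ z, g z + (q z : EReal) ≤ g x₀ + (q x₀ : EReal) → g z < ⊤ := by
    intro z hz
    by_contra hzt
    rw [not_lt_top_iff.1 hzt, EReal.top_add_coe, top_le_iff] at hz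
    exact (EReal.add_lt_top hx₀.ne (EReal.coe_ne_top _)).ne hz
  obtain ⟨y₀, -, hy₀⟩ := hmin 1 zero_le_one
  have hy₀x := hy₀ x₀ (Metric.mem_closedBall_self zero_le_one)
  have hy₀t := hfin y₀ hy₀x
  rw [hg.toReal_add_le_iff hy₀t hx₀] at hy₀x
  set A := (g x₀).toReal + q x₀ with hA
  set m := (g y₀).toReal + q y₀ with hm
  have hR : (1 : ℝ) ≤ 1 + 2 * (A - m) / α := by
    have : 0 ≤ 2 * (A - m) / α := div_nonneg (by linarith) hα.le
    linarith
  -- This radius is where the quadratic gain `α (r - 1) / 2` on the segment outweighs `A - m`.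
  obtain ⟨z, -, hz⟩ := hmin (1 + 2 * (A - m) / α) (by linarith)
  refine ⟨z, fun y => ?_⟩
  by_cases hy : y ∈ Metric.closedBall x₀ (1 + 2 * (A - m) / α)
  · exact hz y hy
  refine (hz x₀ (Metric.mem_closedBall_self (by linarith))).trans ?_
  by_cases hyt : g y < ⊤
  swap
  · rw [not_lt_top_iff.1 hyt, EReal.top_add_coe]
    exact le_top
  rw [hg.toReal_add_le_iff hx₀ hyt]
  rw [Metric.mem_closedBall, dist_eq_norm, not_le] at hy
  set r := ‖y - x₀‖ with hr
  have hr1 : 1 < r := by linarith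
  have hr0 : 0 < r := by linarith
  have hrm : 2 * (A - m) ≤ α * (r - 1) := by
    have : 2 * (A - m) / α ≤ r - 1 := by linarith
    rw [div_le_iff₀ hα] at this
    linarith
  have hab : (1 - r⁻¹) + r⁻¹ = 1 := by ring
  have hi1 : r⁻¹ ≤ 1 := inv_le_one_of_one_le₀ hr1.le
  have hi0 : 0 ≤ r⁻¹ := (inv_pos.2 hr0).le
  have hs := (hg.strongConvex_add hsc).2 hx₀ hyt (sub_nonneg.2 hi1) hi0 hab
  have hp := hg.convexOn_toReal.1 hx₀ hyt (sub_nonneg.2 hi1) hi0 hab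
  set p := (1 - r⁻¹) • x₀ + r⁻¹ • y with hpdef
  have hpx : p - x₀ = r⁻¹ • (y - x₀) := by
    rw [hpdef]
    module
  have hpb : p ∈ Metric.closedBall x₀ 1 := by
    rw [Metric.mem_closedBall, dist_eq_norm, hpx, norm_smul, Real.norm_of_nonneg hi0,
      inv_mul_cancel₀ hr0.ne']
  have hm2 := (hg.toReal_add_le_iff hy₀t hp _ _).1 (hy₀ p hpb)
  simp only [smul_eq_mul] at hs
  rw [norm_sub_rev, ← hr] at hs
  set B := (g y).toReal + q y with hB
  have h1 : m ≤ (1 - r⁻¹) * A + r⁻¹ * B - (1 - r⁻¹) * r⁻¹ * (α / 2 * r ^ 2) := by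
    linarith
  have h2 : m * r ≤ (r - 1) * A + B - (r - 1) * (α / 2 * r) := by
    have := mul_le_mul_of_nonneg_right h1 hr0.le
    have e : ((1 - r⁻¹) * A + r⁻¹ * B - (1 - r⁻¹) * r⁻¹ * (α / 2 * r ^ 2)) * r =
        (r - 1) * A + B - (r - 1) * (α / 2 * r) := by
      field_simp
    linarith
  nlinarith

/-- Strong convexity on the segment from `z` to `y`, together with minimality of `z`, gives the
inequality with `D` replaced by `(1 - s) D`; then `s` tends to 0. -/
theorem growth_of_minimizer (hg : ProperClosedConvex g) {q : X → ℝ} {α : ℝ} (hα : 0 ≤ α)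
    (hsc : StrongConvexOn Set.univ α q) {z : X}
    (hz : ∀ y, g z + (q z : EReal) ≤ g y + (q y : EReal)) :
    g z < ⊤ ∧ ∀ y, g y < ⊤ →
      (g z).toReal + q z + α / 2 * ‖y - z‖ ^ 2 ≤ (g y).toReal + q y := by
  have hzt : g z < ⊤ := by
    obtain ⟨x₀, hx₀⟩ := hg.dom_nonempty
    by_contra hzt
    have h := hz x₀
    rw [not_lt_top_iff.1 hzt, EReal.top_add_coe, top_le_iff] at h
    exact (EReal.add_lt_top hx₀.ne (EReal.coe_ne_top _)).ne h
  refine ⟨hzt, fun y hy => ?_⟩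
  set D := α / 2 * ‖y - z‖ ^ 2 with hD
  have hD0 : 0 ≤ D := by positivity
  have key : ∀ s : ℝ, 0 < s → s < 1 →
      (1 - s) * D ≤ (g y).toReal + q y - ((g z).toReal + q z) := by
    intro s hs0 hs1
    have hab : (1 - s) + s = 1 := by ring
    have h1 := (hg.strongConvex_add hsc).2 hzt hy (sub_nonneg.2 hs1.le) hs0.le hab
    have h2 := (hg.toReal_add_le_iff hzt
      (hg.convexOn_toReal.1 hzt hy (sub_nonneg.2 hs1.le) hs0.le hab) _ _).1 (hz _)
    simp only [smul_eq_mul] at h1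
    rw [norm_sub_rev, ← hD] at h1
    refine le_of_mul_le_mul_left ?_ hs0
    nlinarith
  by_contra hcon
  have hhalf := key (1 / 2) (by norm_num) (by norm_num)
  set B := (g y).toReal + q y - ((g z).toReal + q z) with hB
  have hBD : B < D := by linarith
  have hB0 : 0 ≤ B := by nlinarith
  have hDpos : 0 < D := by linarith
  -- In place of a limit: this `s` turns the bound into `(D + B) / 2 ≤ B`, contradicting `B < D`.
  have h := key ((D - B) / (2 * D)) (div_pos (by linarith) (by linarith))
    ((div_lt_one (by linarith)).2 (by linarith))
  have e : (1 - (D - B) / (2 * D)) * D = (D + B) / 2 := by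
    field_simp
    ring
  linarith

theorem argmin_add_spec [ProperSpace X] (hg : ProperClosedConvex g) {q : X → ℝ}
    (hq : Continuous q) {α : ℝ} (hα : 0 < α) (hsc : StrongConvexOn Set.univ α q) :
    (∀ y, g (argmin fun z => g z + (q z : EReal)) + (q (argmin fun z => g z + (q z : EReal)) : EReal)
      ≤ g y + (q y : EReal)) ∧
    g (argmin fun z => g z + (q z : EReal)) < ⊤ ∧ ∀ y, g y < ⊤ →
      (g (argmin fun z => g z + (q z : EReal))).toReal + q (argmin fun z => g z + (q z : EReal)) +
        α / 2 * ‖y - argmin fun z => g z + (q z : EReal)‖ ^ 2 ≤ (g y).toReal + q y := by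
  have h := argmin_spec (hg.exists_minimizer hq hα hsc)
  exact ⟨h, hg.growth_of_minimizer hα.le hsc h⟩

end ProperClosedConvex

theorem strongConvexOn_add_norm_sq {r : X → ℝ} (hr : ConvexOn ℝ Set.univ r) (t : ℝ) (x : X) :
    StrongConvexOn Set.univ t⁻¹ fun z => r z + ‖z - x‖ ^ 2 / (2 * t) := by
  rw [strongConvexOn_iff_convex]
  have e : (fun z : X => r z + ‖z - x‖ ^ 2 / (2 * t) - t⁻¹ / 2 * ‖z‖ ^ 2) =
      fun z => r z + (‖x‖ ^ 2 / (2 * t) + (-t⁻¹) * inner ℝ x z) := by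
    funext z
    rw [norm_sub_sq_real, real_inner_comm]
    ring
  rw [e]
  refine hr.add ((convexOn_const _ convex_univ).add ?_)
  have := (((-t⁻¹) • innerSL ℝ x : X →L[ℝ] ℝ).toLinearMap.convexOn (convex_univ))
  exact this

/-- The proximal point `q = prox_{t g}(x)` is characterized by `t⁻¹ (x - q) ∈ ∂g(q)`. -/
theorem ProperClosedConvex.prox_spec [ProperSpace X] {g : X → EReal} (hg : ProperClosedConvex g)
    {t : ℝ} (ht : 0 < t) (x : X) :
    g (prox t g x) < ⊤ ∧ ∀ y, g y < ⊤ →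
      (g (prox t g x)).toReal + t⁻¹ * inner ℝ (x - prox t g x) (y - prox t g x) ≤ (g y).toReal := by
  have hsc := strongConvexOn_add_norm_sq (convexOn_const (0 : ℝ) (convex_univ (E := X))) t x
  simp only [zero_add] at hsc
  obtain ⟨-, h1, h2⟩ := hg.argmin_add_spec (by fun_prop) (inv_pos.2 ht) hsc
  refine ⟨h1, fun y hy => ?_⟩
  have h := h2 y hy
  change (g (prox t g x)).toReal + ‖prox t g x - x‖ ^ 2 / (2 * t) +
    t⁻¹ / 2 * ‖y - prox t g x‖ ^ 2 ≤ (g y).toReal + ‖y - x‖ ^ 2 / (2 * t) at h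
  set p := prox t g x
  have e : ‖y - x‖ ^ 2 = ‖y - p‖ ^ 2 - 2 * inner ℝ (x - p) (y - p) + ‖p - x‖ ^ 2 := by
    rw [show y - x = (y - p) - (x - p) by abel, norm_sub_sq_real, real_inner_comm,
      norm_sub_rev p x]
  rw [e] at h
  have e2 : (‖y - p‖ ^ 2 - 2 * inner ℝ (x - p) (y - p) + ‖p - x‖ ^ 2) / (2 * t) =
      t⁻¹ / 2 * ‖y - p‖ ^ 2 - t⁻¹ * inner ℝ (x - p) (y - p) + ‖p - x‖ ^ 2 / (2 * t) := by
    field_simp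
  linarith

theorem ProperClosedConvex.of_real {h : X → ℝ} (hc : Continuous h)
    (hconv : ConvexOn ℝ Set.univ h) : ProperClosedConvex fun z => (h z : EReal) where
  dom_nonempty := ⟨0, EReal.coe_lt_top _⟩
  ne_bot _ := EReal.coe_ne_bot _
  closed_epi := by
    simp only [EReal.coe_le_coe_iff]
    exact isClosed_le (by fun_prop) continuous_snd
  convex_epi := by
    simp only [EReal.coe_le_coe_iff]
    simpa using hconv.convex_epigraph

end Minimizers

/-! ### The Moreau envelope of a Lipschitz convex function -/

section Moreau

variable {Y : Type} [NormedAddCommGroup Y] [InnerProductSpace ℝ Y]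

/-- The gradient `ν⁻¹ (y - prox_{ν h}(y))` of the Moreau envelope `h_ν`. -/
noncomputable def moreauGrad (ν : ℝ) (h : Y → ℝ) (y : Y) : Y :=
  ν⁻¹ • (y - prox ν (fun z => (h z : EReal)) y)

theorem continuous_of_abs_sub_le {Y : Type} [NormedAddCommGroup Y] {h : Y → ℝ} {L : ℝ}
    (hL : ∀ y z, |h y - h z| ≤ L * ‖y - z‖) : Continuous h := by
  refine (LipschitzWith.of_dist_le_mul (K := L.toNNReal) fun y z => ?_).continuous
  rw [Real.dist_eq, dist_eq_norm]
  exact (hL y z).trans (mul_le_mul_of_nonneg_right (Real.le_coe_toNNReal L) (norm_nonneg _))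

theorem prox_eq_sub_moreauGrad {h : Y → ℝ} {ν : ℝ} (hν : 0 < ν) (y : Y) :
    prox ν (fun z => (h z : EReal)) y = y - ν • moreauGrad ν h y := by
  rw [moreauGrad, smul_inv_smul₀ hν.ne']
  abel

variable [ProperSpace Y] {h : Y → ℝ} {ν : ℝ}

theorem prox_subgradient (hc : Continuous h) (hconv : ConvexOn ℝ Set.univ h) (hν : 0 < ν)
    (y z : Y) :
    h (prox ν (fun z => (h z : EReal)) y) +
      ν⁻¹ * inner ℝ (y - prox ν (fun z => (h z : EReal)) y)
        (z - prox ν (fun z => (h z : EReal)) y) ≤ h z := by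
  simpa using ((ProperClosedConvex.of_real hc hconv).prox_spec hν y).2 z (EReal.coe_lt_top _)

/-- A point `p` with `ν⁻¹ (y - p) ∈ ∂h(p)` is `prox_{ν h}(y)`. -/
theorem prox_eq_of_subgradient (hc : Continuous h) (hconv : ConvexOn ℝ Set.univ h) (hν : 0 < ν)
    {y p : Y} (hp : ∀ z, h p + ν⁻¹ * inner ℝ (y - p) (z - p) ≤ h z) :
    prox ν (fun z => (h z : EReal)) y = p := by
  have h1 := prox_subgradient hc hconv hν y p
  set q := prox ν (fun z => (h z : EReal)) y
  have h2 := hp q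
  -- Monotonicity of the subdifferential: adding the two subgradient inequalities leaves `‖q - p‖² ≤
  -- 0`.
  have e : inner ℝ (y - q) (p - q) + inner ℝ (y - p) (q - p) = ‖q - p‖ ^ 2 := by
    rw [← real_inner_self_eq_norm_sq, ← neg_sub q p, inner_neg_right, ← sub_eq_neg_add,
      ← inner_sub_left]
    congr 1
    abel
  have h3 : ν⁻¹ * ‖q - p‖ ^ 2 ≤ 0 := by
    rw [← e]
    linarith
  have h4 : ‖q - p‖ ^ 2 ≤ 0 := by
    by_contra hcon
    exact absurd h3 (not_le.2 (mul_pos (inv_pos.2 hν) (not_le.1 hcon)))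
  rw [← sub_eq_zero, ← norm_eq_zero]
  exact pow_eq_zero_iff two_ne_zero |>.1 (le_antisymm h4 (sq_nonneg _))

/-- Besides showing that the infimum is attained, this bounds its range from below, without which
the real-valued `⨅` in `moreau` would be a default value. -/
theorem prox_env_le (hc : Continuous h) (hconv : ConvexOn ℝ Set.univ h) (hν : 0 < ν) (y z : Y) :
    h (prox ν (fun z => (h z : EReal)) y) + ‖prox ν (fun z => (h z : EReal)) y - y‖ ^ 2 / (2 * ν) ≤
      h z + ‖z - y‖ ^ 2 / (2 * ν) := by
  have h1 := prox_subgradient hc hconv hν y z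
  set p := prox ν (fun z => (h z : EReal)) y
  have e : ‖z - y‖ ^ 2 = ‖z - p‖ ^ 2 - 2 * inner ℝ (y - p) (z - p) + ‖p - y‖ ^ 2 := by
    rw [show z - y = (z - p) - (y - p) by abel, norm_sub_sq_real, real_inner_comm,
      norm_sub_rev p y]
  have e2 : ‖z - y‖ ^ 2 / (2 * ν) = ‖z - p‖ ^ 2 / (2 * ν) - ν⁻¹ * inner ℝ (y - p) (z - p) +
      ‖p - y‖ ^ 2 / (2 * ν) := by
    rw [e]
    field_simp
  have : 0 ≤ ‖z - p‖ ^ 2 / (2 * ν) := by positivity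
  linarith

theorem moreau_le (hc : Continuous h) (hconv : ConvexOn ℝ Set.univ h) (hν : 0 < ν) (y z : Y) :
    moreau ν h y ≤ h z + ‖z - y‖ ^ 2 / (2 * ν) :=
  ciInf_le ⟨_, Set.forall_mem_range.2 (prox_env_le hc hconv hν y)⟩ z

theorem moreau_eq (hc : Continuous h) (hconv : ConvexOn ℝ Set.univ h) (hν : 0 < ν) (y : Y) :
    moreau ν h y = h (prox ν (fun z => (h z : EReal)) y) + ν / 2 * ‖moreauGrad ν h y‖ ^ 2 := by
  have e : ν / 2 * ‖moreauGrad ν h y‖ ^ 2 =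
      ‖prox ν (fun z => (h z : EReal)) y - y‖ ^ 2 / (2 * ν) := by
    rw [moreauGrad, norm_smul, mul_pow, norm_inv, Real.norm_of_nonneg hν.le, norm_sub_rev]
    field_simp
  rw [e]
  exact le_antisymm (moreau_le hc hconv hν y _) (le_ciInf (prox_env_le hc hconv hν y))

theorem moreauGrad_subgradient_prox (hc : Continuous h) (hconv : ConvexOn ℝ Set.univ h)
    (hν : 0 < ν) (y z : Y) :
    h (prox ν (fun z => (h z : EReal)) y) +
      inner ℝ (moreauGrad ν h y) (z - prox ν (fun z => (h z : EReal)) y) ≤ h z := by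
  rw [moreauGrad, real_inner_smul_left]
  exact prox_subgradient hc hconv hν y z

/-- The gradient `u` at `y` is a subgradient of `h` at the proximal point `y - ν u`. Evaluating it
at the proximal point of `z` leaves the surplus `ν/2 ‖u - v‖²`, where `v` is the gradient at `z`. -/
theorem moreau_lower (hc : Continuous h) (hconv : ConvexOn ℝ Set.univ h) (hν : 0 < ν) (y z : Y) :
    moreau ν h y + inner ℝ (moreauGrad ν h y) (z - y) ≤ moreau ν h z := by
  have h1 := moreauGrad_subgradient_prox hc hconv hν y (prox ν (fun z => (h z : EReal)) z)
  rw [moreau_eq hc hconv hν y, moreau_eq hc hconv hν z]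
  set u := moreauGrad ν h y with hu
  set v := moreauGrad ν h z with hv
  have e : inner ℝ u (prox ν (fun z => (h z : EReal)) z - prox ν (fun z => (h z : EReal)) y) =
      inner ℝ u (z - y) - ν * inner ℝ u v + ν * ‖u‖ ^ 2 := by
    rw [prox_eq_sub_moreauGrad hν y, prox_eq_sub_moreauGrad hν z, ← hu, ← hv,
      show z - ν • v - (y - ν • u) = (z - y) - ν • v + ν • u by module, inner_add_right,
      inner_sub_right, real_inner_smul_right, real_inner_smul_right, real_inner_self_eq_norm_sq]
  have h2 : 0 ≤ ν / 2 * ‖u - v‖ ^ 2 := by positivity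
  rw [norm_sub_sq_real] at h2
  linarith

/-- The proximal point of `y` is a trial point in the infimum that defines the envelope at `z`. -/
theorem moreau_upper (hc : Continuous h) (hconv : ConvexOn ℝ Set.univ h) (hν : 0 < ν) (y z : Y) :
    moreau ν h z ≤ moreau ν h y + inner ℝ (moreauGrad ν h y) (z - y) +
      ν⁻¹ / 2 * ‖z - y‖ ^ 2 := by
  have h1 := moreau_le hc hconv hν z (prox ν (fun z => (h z : EReal)) y)
  rw [moreau_eq hc hconv hν y]
  set u := moreauGrad ν h y with hu
  have e : ‖prox ν (fun z => (h z : EReal)) y - z‖ ^ 2 / (2 * ν) =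
      ν⁻¹ / 2 * ‖z - y‖ ^ 2 + inner ℝ u (z - y) + ν / 2 * ‖u‖ ^ 2 := by
    rw [prox_eq_sub_moreauGrad hν y, ← hu, show y - ν • u - z = -((z - y) + ν • u) by module,
      norm_neg, norm_add_sq_real, real_inner_smul_right, norm_smul, Real.norm_of_nonneg hν.le,
      real_inner_comm]
    field_simp
  linarith

/-- The gradient `w` is a subgradient of `h` at `p`; testing at `p + w` gives `‖w‖² ≤ L ‖w‖`. -/
theorem norm_moreauGrad_le {L : ℝ} (hL0 : 0 ≤ L) (hL : ∀ y z, |h y - h z| ≤ L * ‖y - z‖)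
    (hconv : ConvexOn ℝ Set.univ h) (hν : 0 < ν) (y : Y) : ‖moreauGrad ν h y‖ ≤ L := by
  have hc := continuous_of_abs_sub_le hL
  set w := moreauGrad ν h y with hw
  set p := prox ν (fun z => (h z : EReal)) y
  have h1 := moreauGrad_subgradient_prox hc hconv hν y (p + w)
  have h2 := (le_abs_self _).trans (hL (p + w) p)
  rw [add_sub_cancel_left] at h1 h2
  rw [real_inner_self_eq_norm_sq] at h1
  nlinarith [norm_nonneg w]

theorem moreau_abs_sub_le {L : ℝ} (hL0 : 0 ≤ L) (hL : ∀ y z, |h y - h z| ≤ L * ‖y - z‖)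
    (hconv : ConvexOn ℝ Set.univ h) (hν : 0 < ν) (y z : Y) :
    |moreau ν h y - moreau ν h z| ≤ L * ‖y - z‖ := by
  have hc := continuous_of_abs_sub_le hL
  have key : ∀ y z, moreau ν h y - moreau ν h z ≤ L * ‖y - z‖ := by
    intro y z
    have h1 := moreau_lower hc hconv hν y z
    have h2 := real_inner_le_norm (moreauGrad ν h y) (y - z)
    have h3 := mul_le_mul_of_nonneg_right (norm_moreauGrad_le hL0 hL hconv hν y)
      (norm_nonneg (y - z))
    rw [← neg_sub y z, inner_neg_right] at h1
    linarith
  rw [abs_le]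
  refine ⟨?_, key y z⟩
  have := key z y
  rw [norm_sub_rev] at this
  linarith

theorem convexOn_moreau (hc : Continuous h) (hconv : ConvexOn ℝ Set.univ h) (hν : 0 < ν) :
    ConvexOn ℝ Set.univ (moreau ν h) := by
  refine ⟨convex_univ, fun x _ y _ a b ha hb hab => ?_⟩
  have h1 := mul_le_mul_of_nonneg_left (moreau_lower hc hconv hν (a • x + b • y) x) ha
  have h2 := mul_le_mul_of_nonneg_left (moreau_lower hc hconv hν (a • x + b • y) y) hb
  set p := a • x + b • y with hp
  set w := moreauGrad ν h p
  have e : a * inner ℝ w (x - p) + b * inner ℝ w (y - p) = 0 := by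
    rw [← real_inner_smul_right, ← real_inner_smul_right, ← inner_add_right]
    have : a • (x - p) + b • (y - p) = 0 := by
      rw [show a • (x - p) + b • (y - p) = (a • x + b • y) - (a + b) • p by module, hab, ← hp]
      simp
    rw [this, inner_zero_right]
  have e2 : a * moreau ν h p + b * moreau ν h p = moreau ν h p := by
    rw [← add_mul, hab, one_mul]
  simp only [smul_eq_mul]
  linarith

theorem moreau_le_self (hc : Continuous h) (hconv : ConvexOn ℝ Set.univ h) (hν : 0 < ν) (y : Y) :
    moreau ν h y ≤ h y := by
  simpa using moreau_le hc hconv hν y y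

/-- With `u` the gradient, the gap is at most `ν (L ‖u‖ - ‖u‖²/2)`, which is largest at `‖u‖ = L`.
-/
theorem self_le_moreau_add {L : ℝ} (hL : ∀ y z, |h y - h z| ≤ L * ‖y - z‖)
    (hconv : ConvexOn ℝ Set.univ h) (hν : 0 < ν) (y : Y) :
    h y ≤ moreau ν h y + L ^ 2 * ν / 2 := by
  have hc := continuous_of_abs_sub_le hL
  have h1 := (le_abs_self _).trans (hL y (prox ν (fun z => (h z : EReal)) y))
  rw [moreau_eq hc hconv hν y]
  have e : ‖y - prox ν (fun z => (h z : EReal)) y‖ = ν * ‖moreauGrad ν h y‖ := by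
    rw [prox_eq_sub_moreauGrad hν y, sub_sub_cancel, norm_smul, Real.norm_of_nonneg hν.le]
  rw [e] at h1
  have : 0 ≤ ν * (L - ‖moreauGrad ν h y‖) ^ 2 := by positivity
  linarith

/-- The point `q = ν/(s+ν) y + s/(s+ν) prox_{(s+ν) h}(y)` satisfies `∇h_ν(q) = s⁻¹ (y - q)`, that is,
`q = prox_{s h_ν}(y)`. -/
theorem moreauGrad_env_prox (hc : Continuous h) (hconv : ConvexOn ℝ Set.univ h) (hν : 0 < ν)
    {s : ℝ} (hs : 0 < s) {y q : Y}
    (hq : q = (ν / (s + ν)) • y + (s / (s + ν)) • prox (s + ν) (fun z => (h z : EReal)) y) :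
    moreauGrad ν h q = s⁻¹ • (y - q) := by
  have hsν : 0 < s + ν := by positivity
  have h1 := prox_subgradient hc hconv hsν y
  set p := prox (s + ν) (fun z => (h z : EReal)) y
  have e1 : ν / (s + ν) + s / (s + ν) = 1 := by
    field_simp
    ring
  have hqp : q - p = (ν / (s + ν)) • (y - p) := by
    have : p = (ν / (s + ν) + s / (s + ν)) • p := by rw [e1, one_smul]
    calc q - p = q - (ν / (s + ν) + s / (s + ν)) • p := by rw [← this]
      _ = _ := by
        rw [hq]
        module
  have hyq : y - q = (s / (s + ν)) • (y - p) := by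
    have : y = (ν / (s + ν) + s / (s + ν)) • y := by rw [e1, one_smul]
    calc y - q = (ν / (s + ν) + s / (s + ν)) • y - q := by rw [← this]
      _ = _ := by
        rw [hq]
        module
  -- `ν⁻¹ (q - p)` and `(s+ν)⁻¹ (y - p)` are the same vector, so one subgradient of `h` at `p`
  -- certifies both proximal points.
  have hp : prox ν (fun z => (h z : EReal)) q = p := by
    refine prox_eq_of_subgradient hc hconv hν fun z => ?_
    rw [hqp, real_inner_smul_left, ← mul_assoc,
      show ν⁻¹ * (ν / (s + ν)) = (s + ν)⁻¹ by field_simp]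
    exact h1 z
  rw [moreauGrad, hp, hqp, hyq, smul_smul, smul_smul]
  congr 1
  field_simp

end Moreau

/-! ### Smooth convex functions, in terms of their quadratic bounds -/

/-- `f'` is a gradient of the convex function `f` whose first-order model has quadratic error at most
`l/2 ‖y - x‖²`. -/
structure SmoothConvex {X : Type} [NormedAddCommGroup X] [InnerProductSpace ℝ X]
    (f : X → ℝ) (f' : X → X) (l : ℝ) : Prop where
  lower : ∀ x y, f x + inner ℝ (f' x) (y - x) ≤ f y
  upper : ∀ x y, f y ≤ f x + inner ℝ (f' x) (y - x) + l / 2 * ‖y - x‖ ^ 2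

namespace SmoothConvex

variable {X : Type} [NormedAddCommGroup X] [InnerProductSpace ℝ X] {f : X → ℝ} {f' : X → X} {l : ℝ}

/-- Both quadratic bounds are compared at the gradient step `y - l⁻¹ (f' y - f' x)`, which minimizes
the upper bound at `y` minus the affine bound at `x`. -/
theorem lower_sq (hf : SmoothConvex f f' l) (hl : 0 < l) (x y : X) :
    f x + inner ℝ (f' x) (y - x) + l⁻¹ / 2 * ‖f' y - f' x‖ ^ 2 ≤ f y := by
  set d := f' y - f' x with hd
  have h1 := hf.lower x (y - l⁻¹ • d)
  have h2 := hf.upper y (y - l⁻¹ • d)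
  rw [show y - l⁻¹ • d - x = (y - x) - l⁻¹ • d by abel, inner_sub_right,
    real_inner_smul_right] at h1
  rw [show y - l⁻¹ • d - y = -(l⁻¹ • d) by abel, norm_neg, inner_neg_right, norm_smul,
    real_inner_smul_right, norm_inv, Real.norm_of_nonneg hl.le] at h2
  have e : inner ℝ (f' y) d - inner ℝ (f' x) d = ‖d‖ ^ 2 := by
    rw [← inner_sub_left, ← hd, real_inner_self_eq_norm_sq]
  have e2 : l⁻¹ * inner ℝ (f' y) d = l⁻¹ * inner ℝ (f' x) d + l⁻¹ * ‖d‖ ^ 2 := by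
    rw [← e]
    ring
  have e3 : l / 2 * (l⁻¹ * ‖d‖) ^ 2 = l⁻¹ / 2 * ‖d‖ ^ 2 := by
    field_simp
  linarith

theorem cocoercive (hf : SmoothConvex f f' l) (hl : 0 < l) (x y : X) :
    l⁻¹ * ‖f' y - f' x‖ ^ 2 ≤ inner ℝ (f' y - f' x) (y - x) := by
  have h1 := hf.lower_sq hl x y
  have h2 := hf.lower_sq hl y x
  rw [← neg_sub y x, inner_neg_right, norm_sub_rev] at h2
  rw [inner_sub_left]
  linarith

theorem grad_lipschitz (hf : SmoothConvex f f' l) (hl : 0 < l) (x y : X) :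
    ‖f' y - f' x‖ ≤ l * ‖y - x‖ := by
  have h1 := (hf.cocoercive hl x y).trans (real_inner_le_norm _ _)
  by_cases h0 : ‖f' y - f' x‖ = 0
  · rw [h0]
    positivity
  have hpos : 0 < ‖f' y - f' x‖ := lt_of_le_of_ne (norm_nonneg _) (Ne.symm h0)
  rw [inv_mul_le_iff₀ hl] at h1
  nlinarith

end SmoothConvex

/-! ### Running programs -/

section Run

variable {E Y : Type} [NormedAddCommGroup E] [InnerProductSpace ℝ E] [CompleteSpace E]
  [NormedAddCommGroup Y] [InnerProductSpace ℝ Y] [CompleteSpace Y]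

namespace Prog

variable (P : CompositeProblem E Y)

@[simp]
theorem run_pure {α : Type} (a : α) : run P (pure a : Prog E Y α) = (a, 0) := rfl

theorem run_seq {α γ : Type} (p : Prog E Y α) (f : α → Prog E Y γ) :
    run P (p.seq f) = ((run P (f (run P p).1)).1, (run P p).2 + (run P (f (run P p).1)).2) := by
  induction p with
  | ret a => simp [seq, run]
  | evalC x k ih => simp [seq, run, ih, add_right_comm]
  | jac x v k ih => simp [seq, run, ih, add_right_comm]
  | jacAdj x w k ih => simp [seq, run, ih, add_right_comm]
  | proxG t x k ih => simp [seq, run, ih, add_right_comm]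
  | proxH t y k ih => simp [seq, run, ih, add_right_comm]

@[simp]
theorem run_bind_fst {α γ : Type} (p : Prog E Y α) (f : α → Prog E Y γ) :
    (run P (p >>= f)).1 = (run P (f (run P p).1)).1 := by
  rw [show p >>= f = p.seq f from rfl, run_seq]

@[simp]
theorem run_bind_snd {α γ : Type} (p : Prog E Y α) (f : α → Prog E Y γ) :
    (run P (p >>= f)).2 = (run P p).2 + (run P (f (run P p).1)).2 := by
  rw [show p >>= f = p.seq f from rfl, run_seq]

@[simp]
theorem run_askC (x : E) : run P (askC x) = (P.c x, 1) := rfl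

@[simp]
theorem run_askJac (x v : E) : run P (askJac x v) = (fderiv ℝ P.c x v, 1) := rfl

@[simp]
theorem run_askJacAdj (x : E) (w : Y) :
    run P (askJacAdj x w) = (ContinuousLinearMap.adjoint (fderiv ℝ P.c x) w, 1) := rfl

@[simp]
theorem run_askProxG (t : ℝ) (x : E) :
    run P (askProxG t x : Prog E Y E) = (prox t P.g x, 1) := rfl

@[simp]
theorem run_askProxH (t : ℝ) (y : Y) :
    run P (askProxH t y : Prog E Y Y) = (prox t (fun z => (P.h z : EReal)) y, 1) := rfl

end Prog

/-! ### The rate of the fast-gradient method -/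

/-- The variational characterization of `q = prox_{τ p}(u)` for an `α`-strongly convex `p` with
domain `D`. -/
def IsProxPoint {X : Type} [NormedAddCommGroup X] [InnerProductSpace ℝ X] (D : Set X) (p : X → ℝ)
    (α τ : ℝ) (u q : X) : Prop :=
  q ∈ D ∧ ∀ z ∈ D, p q + τ⁻¹ * inner ℝ (u - q) (z - q) + α / 2 * ‖z - q‖ ^ 2 ≤ p z

variable {X : Type} [NormedAddCommGroup X] [InnerProductSpace ℝ X]

/-- The invariant of the fast-gradient method: the estimating function
`‖z - z₀‖² / 2 + c + ⟨S, z⟩ + θ p(z)`, whose affine part is below `θ f`, is minimized at `v`, and its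
minimum is at least `θ (f + p)(x)`. -/
structure FGInvariant (D : Set X) (f p : X → ℝ) (α : ℝ) (z₀ : X) (s : FGState X) (c : ℝ) : Prop where
  θ_nonneg : 0 ≤ s.θ
  mem_of_pos : 0 < s.θ → s.x ∈ D
  affine_le : ∀ z, c + inner ℝ s.S z ≤ s.θ * f z
  estimate : ∀ z ∈ D, s.θ * (f s.x + p s.x) + (1 + α * s.θ) / 2 * ‖z - s.v‖ ^ 2 ≤
    1 / 2 * ‖z - z₀‖ ^ 2 + c + inner ℝ s.S z + s.θ * p z

/-- Replacing the affine part of the estimating function by `θ f` gives a gap of at most `‖z - z₀‖²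
/ (2θ)`, so the rate is decided by the growth of `θ`. -/
theorem FGInvariant.gap_le {D : Set X} {f p : X → ℝ} {α : ℝ} {z₀ : X} {s : FGState X} {c : ℝ}
    (hs : FGInvariant D f p α z₀ s c) (hα : 0 ≤ α) {z : X} (hz : z ∈ D) :
    s.θ * (f s.x + p s.x) ≤ 1 / 2 * ‖z - z₀‖ ^ 2 + s.θ * (f z + p z) := by
  have h1 := hs.estimate z hz
  have h2 := hs.affine_le z
  have h3 : 0 ≤ (1 + α * s.θ) / 2 * ‖z - s.v‖ ^ 2 := by
    have := hs.θ_nonneg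
    positivity
  linarith

/-- The positive root `a` of `a² = κ (θ + a)`. -/
theorem fg_root {κ θ : ℝ} (hκ : 0 < κ) (hθ : 0 ≤ θ) :
    0 < (κ + √(κ ^ 2 + 4 * κ * θ)) / 2 ∧
      ((κ + √(κ ^ 2 + 4 * κ * θ)) / 2) ^ 2 = κ * (θ + (κ + √(κ ^ 2 + 4 * κ * θ)) / 2) := by
  have h0 : 0 ≤ κ ^ 2 + 4 * κ * θ := by positivity
  have h1 := Real.sq_sqrt h0
  refine ⟨by positivity, ?_⟩
  nlinarith

/-- A quadratic form with nonpositive discriminant: expand `‖a w + κ z‖² ≥ 0`. -/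
theorem fg_inner_lower {κ a b : ℝ} (hκ : 0 < κ) (hab : a ^ 2 ≤ 2 * κ * b) (w z : X) :
    0 ≤ b * ‖w‖ ^ 2 + a * inner ℝ w z + κ / 2 * ‖z‖ ^ 2 := by
  have h1 : 0 ≤ ‖a • w + κ • z‖ ^ 2 := sq_nonneg _
  rw [norm_add_sq_real, norm_smul, norm_smul, real_inner_smul_left, real_inner_smul_right, mul_pow,
    mul_pow, Real.norm_eq_abs, Real.norm_eq_abs, sq_abs, sq_abs] at h1
  have h2 := mul_le_mul_of_nonneg_right hab (sq_nonneg ‖w‖)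
  have h3 : 0 ≤ κ * (2 * (b * ‖w‖ ^ 2 + a * inner ℝ w z + κ / 2 * ‖z‖ ^ 2)) := by nlinarith
  linarith [nonneg_of_mul_nonneg_right h3 hκ]

/-- One iteration of the fast-gradient method preserves the invariant. -/
theorem FGInvariant.next {D : Set X} {f p : X → ℝ} {f' : X → X} {α l : ℝ} {z₀ : X} {s : FGState X}
    {c : ℝ} (hs : FGInvariant D f p α z₀ s c) (hf : SmoothConvex f f' l) (hl : 0 < l) (hα : 0 ≤ α)
    {a : ℝ} (ha : 0 < a) (ha2 : a ^ 2 = 2 * (1 + α * s.θ) / l * (s.θ + a)) {y x v : X}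
    (hy : y = (s.θ + a)⁻¹ • (s.θ • s.x + a • s.v))
    (hx : IsProxPoint D p α l⁻¹ (y - l⁻¹ • f' y) x)
    (hv : IsProxPoint D p α (s.θ + a) (z₀ - (s.S + a • f' x)) v) :
    FGInvariant D f p α z₀ ⟨s.θ + a, x, v, s.S + a • f' x⟩
      (c + a * (f x - inner ℝ (f' x) x)) := by
  have hθ := hs.θ_nonneg
  have hθ' : 0 < s.θ + a := by linarith
  have hκ : 0 < 1 + α * s.θ := by positivity
  refine ⟨hθ'.le, fun _ => hx.1, fun z => ?_, ?_⟩
  · have h1 := hs.affine_le z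
    have h2 := mul_le_mul_of_nonneg_left (hf.lower x z) ha.le
    rw [inner_sub_right] at h2
    simp only [inner_add_left, real_inner_smul_left]
    linarith
  -- `w` is a subgradient of `f + p` at `x`
  set w : X := l • (y - x) - (f' y - f' x) with hw
  have hsub : ∀ z ∈ D, f x + p x + inner ℝ w (z - x) ≤ f z + p z := by
    intro z hz
    have h1 := hf.lower x z
    have h2 := hx.2 z hz
    have h3 : 0 ≤ α / 2 * ‖z - x‖ ^ 2 := by positivity
    have e : l⁻¹⁻¹ * inner ℝ (y - l⁻¹ • f' y - x) (z - x) + inner ℝ (f' x) (z - x) =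
        inner ℝ w (z - x) := by
      rw [inv_inv, ← real_inner_smul_left, ← inner_add_left, hw]
      congr 1
      rw [smul_sub, smul_sub, smul_inv_smul₀ hl.ne', smul_sub]
      abel
    linarith
  have hpx : ∀ z ∈ D, p x + inner ℝ (w - f' x) (z - x) ≤ p z := by
    intro z hz
    have h2 := hx.2 z hz
    have h3 : 0 ≤ α / 2 * ‖z - x‖ ^ 2 := by positivity
    have e : l⁻¹⁻¹ * inner ℝ (y - l⁻¹ • f' y - x) (z - x) = inner ℝ (w - f' x) (z - x) := by
      rw [inv_inv, ← real_inner_smul_left, hw]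
      congr 1
      rw [smul_sub, smul_sub, smul_inv_smul₀ hl.ne', smul_sub]
      abel
    linarith
  -- Cocoercivity of `f'`, rewritten in terms of `w`.
  have hwsq : l⁻¹ * ‖w‖ ^ 2 ≤ inner ℝ w (y - x) := by
    have h1 := hf.cocoercive hl x y
    have e1 : ‖w‖ ^ 2 = l ^ 2 * ‖y - x‖ ^ 2 - 2 * (l * inner ℝ (f' y - f' x) (y - x)) +
        ‖f' y - f' x‖ ^ 2 := by
      rw [hw, norm_sub_sq_real, norm_smul, real_inner_smul_left, mul_pow, Real.norm_eq_abs, sq_abs,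
        real_inner_comm]
    have e2 : inner ℝ w (y - x) = l * ‖y - x‖ ^ 2 - inner ℝ (f' y - f' x) (y - x) := by
      rw [hw, inner_sub_left, real_inner_smul_left, real_inner_self_eq_norm_sq]
    rw [e1, e2]
    have e3 : l⁻¹ * (l ^ 2 * ‖y - x‖ ^ 2 - 2 * (l * inner ℝ (f' y - f' x) (y - x)) +
        ‖f' y - f' x‖ ^ 2) = l * ‖y - x‖ ^ 2 - 2 * inner ℝ (f' y - f' x) (y - x) +
        l⁻¹ * ‖f' y - f' x‖ ^ 2 := by
      field_simp
    linarith
  -- the minimum of the new estimating function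
  have hmin : (s.θ + a) * (f x + p x) ≤ 1 / 2 * ‖v - z₀‖ ^ 2 +
      (c + a * (f x - inner ℝ (f' x) x)) + inner ℝ (s.S + a • f' x) v + (s.θ + a) * p v := by
    have h1 := hs.estimate v hv.1
    have h2 : s.θ * (f x + p x) + s.θ * inner ℝ w (s.x - x) ≤ s.θ * (f s.x + p s.x) := by
      -- At `θ = 0` the starting point may lie outside `D`, where `hsub` is unavailable; the weight
      -- then removes the term.
      rcases hθ.eq_or_lt with h0 | h0
      · rw [← h0]
        simp
      · have := mul_le_mul_of_nonneg_left (hsub s.x (hs.mem_of_pos h0)) hθ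
        linarith
    have h3 := mul_le_mul_of_nonneg_left (hpx v hv.1) ha.le
    -- The equation defining `a` is the case of zero discriminant here.
    have h4 := fg_inner_lower (b := (s.θ + a) * l⁻¹) hκ
      (by rw [ha2]; exact le_of_eq (by field_simp)) w (v - s.v)
    have h5 := mul_le_mul_of_nonneg_left hwsq hθ'.le
    -- This is why `y` is the weighted mean of `s.x` and `s.v`: the old iterate drops out, and only
    -- `y - x` and `v - s.v` remain.
    have e : s.θ * inner ℝ w (s.x - x) + a * inner ℝ w (v - x) =
        (s.θ + a) * inner ℝ w (y - x) + a * inner ℝ w (v - s.v) := by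
      simp only [← real_inner_smul_right, ← inner_add_right]
      congr 1
      have : (s.θ + a) • y = s.θ • s.x + a • s.v := by
        rw [hy, smul_inv_smul₀ hθ'.ne']
      rw [smul_sub _ y x, this]
      module
    rw [inner_sub_left] at h3
    simp only [inner_add_left, real_inner_smul_left]
    rw [inner_sub_right (f' x)] at h3
    linarith
  intro z hz
  have h1 := mul_le_mul_of_nonneg_left (hv.2 z hz) hθ'.le
  set S := s.S + a • f' x
  have e1 : (s.θ + a) * ((s.θ + a)⁻¹ * inner ℝ (z₀ - S - v) (z - v)) =
      inner ℝ (z₀ - v) (z - v) - inner ℝ S z + inner ℝ S v := by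
    rw [mul_inv_cancel_left₀ hθ'.ne', show z₀ - S - v = (z₀ - v) - S by abel, inner_sub_left,
      inner_sub_right S]
    ring
  have e2 : ‖z - z₀‖ ^ 2 = ‖z - v‖ ^ 2 - 2 * inner ℝ (z₀ - v) (z - v) + ‖v - z₀‖ ^ 2 := by
    rw [show z - z₀ = (z - v) - (z₀ - v) by abel, norm_sub_sq_real, real_inner_comm,
      norm_sub_rev v z₀]
  simp only
  linarith

/-- The growth of the weights `θ_j` in one iteration. -/
theorem fg_weight_growth {α l θ a : ℝ} (hl : 0 < l) (hα : 0 ≤ α) (hθ : 0 ≤ θ) (ha : 0 < a)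
    (ha2 : a ^ 2 = 2 * (1 + α * θ) / l * (θ + a)) :
    (1 + √(α / (2 * l))) ^ 2 * θ ≤ θ + a := by
  set σ := √(α / (2 * l)) with hσ
  have hσ2 : σ ^ 2 = α / (2 * l) := Real.sq_sqrt (by positivity)
  have hσ0 : 0 ≤ σ := Real.sqrt_nonneg _
  -- In terms of the square roots, `2σuw ≤ a = (w - u)(w + u) ≤ 2w(w - u)`, hence `(1 + σ) u ≤ w`.
  set u := √θ with hu
  set w := √(θ + a) with hw
  have hu2 : u ^ 2 = θ := Real.sq_sqrt hθ
  have hw2 : w ^ 2 = θ + a := Real.sq_sqrt (by linarith)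
  have hu0 : 0 ≤ u := Real.sqrt_nonneg _
  have hw0 : 0 < w := Real.sqrt_pos.2 (by linarith)
  have huw : u ≤ w := Real.sqrt_le_sqrt (by linarith)
  have h1 : (2 * σ * u * w) ^ 2 ≤ a ^ 2 := by
    have : (2 * σ * u * w) ^ 2 = 2 * (α * θ) / l * (θ + a) := by
      rw [mul_pow, mul_pow, mul_pow, hσ2, hu2, hw2]
      field_simp
    rw [this, ha2]
    gcongr
    linarith
  have h2 : 2 * σ * u * w ≤ a := by
    exact (sq_le_sq₀ (by positivity) ha.le).1 h1
  have h3 : a = (w - u) * (w + u) := by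
    nlinarith
  have h4 : σ * u ≤ w - u := by
    have : (σ * u) * (2 * w) ≤ (w - u) * (2 * w) := by nlinarith
    exact le_of_mul_le_mul_right this (by positivity)
  have h5 : (1 + σ) * u ≤ w := by linarith
  calc (1 + σ) ^ 2 * θ = ((1 + σ) * u) ^ 2 := by rw [mul_pow, hu2]
    _ ≤ w ^ 2 := by gcongr
    _ = θ + a := hw2

variable {P : CompositeProblem E Y} {D : Set X} {f p : X → ℝ} {f' : X → X} {α l : ℝ}
  {grad : X → Prog E Y X} {proxp : ℝ → X → Prog E Y X}

theorem fastGradient_invariant (hf : SmoothConvex f f' l) (hl : 0 < l) (hα : 0 ≤ α)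
    (hgrad : ∀ y, ((grad y).run P).1 = f' y)
    (hprox : ∀ τ, 0 < τ → ∀ u, IsProxPoint D p α τ u ((proxp τ u).run P).1) (z₀ : X) (T : ℕ) :
    (∃ c, FGInvariant D f p α z₀ ((fastGradient grad proxp α l z₀ T).run P).1 c) ∧
      (1 ≤ T → 2 / l * ((1 + √(α / (2 * l))) ^ 2) ^ (T - 1) ≤
        ((fastGradient grad proxp α l z₀ T).run P).1.θ) := by
  induction T with
  | zero =>
    refine ⟨⟨0, ?_⟩, by simp⟩
    constructor <;> simp [fastGradient]
  | succ T ih =>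
    obtain ⟨⟨c, hc⟩, hθ⟩ := ih
    simp only [fastGradient, Prog.run_bind_fst]
    set s := ((fastGradient grad proxp α l z₀ T).run P).1 with hs
    have hκ : 0 < 2 * (1 + α * s.θ) / l := by
      have := hc.θ_nonneg
      positivity
    obtain ⟨ha, ha2⟩ := fg_root hκ hc.θ_nonneg
    simp only [fgStep, Prog.run_bind_fst, Prog.run_pure, hgrad]
    set a := (2 * (1 + α * s.θ) / l + √((2 * (1 + α * s.θ) / l) ^ 2 +
      4 * (2 * (1 + α * s.θ) / l) * s.θ)) / 2 with hadef
    refine ⟨⟨_, hc.next hf hl hα ha ha2 rfl (hprox _ (inv_pos.2 hl) _)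
      (hprox _ (by linarith [hc.θ_nonneg]) _)⟩, fun _ => ?_⟩
    simp only [Nat.add_sub_cancel]
    -- The first iteration starts from weight 0 and produces exactly `2/l`; geometric growth begins
    -- only afterwards, hence the exponent `T - 1`.
    rcases Nat.eq_zero_or_pos T with h0 | h0
    · have : s.θ = 0 := by
        rw [hs, h0]
        simp [fastGradient]
      subst h0
      have h1 : a * a = a * (2 / l) := by
        rw [this] at ha2
        simp only [mul_zero, add_zero, mul_one, zero_add] at ha2
        linarith
      have h2 := mul_left_cancel₀ ha.ne' h1
      rw [this, h2]
      simp
    · have h1 := fg_weight_growth hl hα hc.θ_nonneg ha ha2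
      have h2 := mul_le_mul_of_nonneg_left (hθ h0) (sq_nonneg (1 + √(α / (2 * l))))
      obtain ⟨n, rfl⟩ : ∃ n, T = n + 1 := ⟨T - 1, by omega⟩
      rw [Nat.add_sub_cancel] at h2
      rw [pow_succ]
      linarith

/-- The rate of the fast-gradient method, against an arbitrary point of the domain. -/
theorem fastGradient_rate (hf : SmoothConvex f f' l) (hl : 0 < l) (hα : 0 ≤ α)
    (hgrad : ∀ y, ((grad y).run P).1 = f' y)
    (hprox : ∀ τ, 0 < τ → ∀ u, IsProxPoint D p α τ u ((proxp τ u).run P).1) (z₀ : X) {T : ℕ}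
    (hT : 1 ≤ T) :
    ((fastGradient grad proxp α l z₀ T).run P).1.x ∈ D ∧ ∀ z ∈ D,
      f ((fastGradient grad proxp α l z₀ T).run P).1.x +
          p ((fastGradient grad proxp α l z₀ T).run P).1.x ≤
        f z + p z + l / 4 * (((1 + √(α / (2 * l))) ^ 2) ^ (T - 1))⁻¹ * ‖z - z₀‖ ^ 2 := by
  obtain ⟨⟨c, hc⟩, hθ⟩ := fastGradient_invariant (P := P) hf hl hα hgrad hprox z₀ T
  set s := ((fastGradient grad proxp α l z₀ T).run P).1
  have h1 := hθ hT
  have hpow : 0 < ((1 + √(α / (2 * l))) ^ 2) ^ (T - 1) := by positivity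
  have hpos : 0 < s.θ := lt_of_lt_of_le (by positivity) h1
  refine ⟨hc.mem_of_pos hpos, fun z hz => ?_⟩
  have h2 := hc.gap_le hα hz
  set Q := ((1 + √(α / (2 * l))) ^ 2) ^ (T - 1)
  have h3 : 1 / 2 * ‖z - z₀‖ ^ 2 ≤ s.θ * (l / 4 * Q⁻¹ * ‖z - z₀‖ ^ 2) := by
    have : 2 / l * Q * (l / 4 * Q⁻¹ * ‖z - z₀‖ ^ 2) = 1 / 2 * ‖z - z₀‖ ^ 2 := by
      field_simp
      ring
    rw [← this]
    gcongr
  refine le_of_mul_le_mul_left ?_ hpos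
  linarith

theorem fastGradient_cost {a b : ℕ} (hgrad : ∀ y, ((grad y).run P).2 = a)
    (hprox : ∀ τ u, ((proxp τ u).run P).2 = b) (z₀ : X) (T : ℕ) :
    ((fastGradient grad proxp α l z₀ T).run P).2 = T * (2 * a + 2 * b) := by
  induction T with
  | zero => simp [fastGradient]
  | succ T ih =>
    simp only [fastGradient, fgStep, Prog.run_bind_snd, ih, hgrad, hprox, Prog.run_pure]
    ring

end Run

/-! ### Descent of the prox-linear method -/

/-- Along the segment the derivative of the remainder has norm at most `β s ‖v‖²`; the mean value
inequality with boundary `β/2 ‖v‖² s²` integrates this. -/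
theorem norm_sub_linearization_le {E Y : Type} [NormedAddCommGroup E] [NormedSpace ℝ E]
    [NormedAddCommGroup Y] [NormedSpace ℝ Y] {c : E → Y} {β : ℝ} (hc : Differentiable ℝ c)
    (hβ : ∀ x y, ‖fderiv ℝ c x - fderiv ℝ c y‖ ≤ β * ‖x - y‖) (x z : E) :
    ‖c z - (c x + fderiv ℝ c x (z - x))‖ ≤ β / 2 * ‖z - x‖ ^ 2 := by
  set v := z - x with hv
  have hderiv : ∀ s : ℝ, HasDerivAt (fun s : ℝ => c (x + s • v) - c x - s • fderiv ℝ c x v)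
      (fderiv ℝ c (x + s • v) v - fderiv ℝ c x v) s := by
    intro s
    have h1 : HasDerivAt (fun s : ℝ => x + s • v) v s := by
      simpa using ((hasDerivAt_id s).smul_const v).const_add x
    have h2 := ((hc (x + s • v)).hasFDerivAt).comp_hasDerivAt s h1
    have h3 : HasDerivAt (fun s : ℝ => s • fderiv ℝ c x v) (fderiv ℝ c x v) s := by
      simpa using (hasDerivAt_id s).smul_const (fderiv ℝ c x v)
    exact (h2.sub_const (c x)).sub h3
  have hB : ∀ s : ℝ, HasDerivAt (fun s : ℝ => β / 2 * ‖v‖ ^ 2 * s ^ 2) (β * s * ‖v‖ ^ 2) s := by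
    intro s
    have := (hasDerivAt_pow 2 s).const_mul (β / 2 * ‖v‖ ^ 2)
    refine this.congr_deriv ?_
    simp
    ring
  have h := image_norm_le_of_norm_deriv_right_le_deriv_boundary (a := 0) (b := 1)
    (f := fun s : ℝ => c (x + s • v) - c x - s • fderiv ℝ c x v)
    (fun s _ => (hderiv s).continuousAt.continuousWithinAt)
    (fun s _ => (hderiv s).hasDerivWithinAt) (by simp) hB (by
      intro s hs
      have h1 := (fderiv ℝ c (x + s • v) - fderiv ℝ c x).le_opNorm v
      have h2 := mul_le_mul_of_nonneg_right (hβ (x + s • v) x) (norm_nonneg v)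
      rw [add_sub_cancel_left, norm_smul, Real.norm_of_nonneg hs.1] at h2
      rw [sub_apply] at h1
      calc _ ≤ _ := h1
        _ ≤ _ := h2
        _ = _ := by ring) (Set.right_mem_Icc.2 zero_le_one)
  simp only [one_smul, one_pow, mul_one] at h
  rwa [hv, add_sub_cancel, ← hv, sub_sub] at h

namespace CompositeProblem

section

variable {E Y : Type} [NormedAddCommGroup E] [InnerProductSpace ℝ E]
  [NormedAddCommGroup Y] [InnerProductSpace ℝ Y]

/-- The objective on `dom g`, as a real number. -/
noncomputable def objReal (P : CompositeProblem E Y) (x : E) : ℝ :=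
  (P.g x).toReal + P.h (P.c x)

/-- The subproblem on `dom g`, as a real number. -/
noncomputable def modelReal (P : CompositeProblem E Y) (t : ℝ) (x z : E) : ℝ :=
  (P.g z).toReal + (P.h (P.c x + fderiv ℝ P.c x (z - x)) + ‖z - x‖ ^ 2 / (2 * t))

variable {P : CompositeProblem E Y} {L β t ν : ℝ}

theorem Standing.continuous_h (hP : P.Standing L β) : Continuous P.h :=
  continuous_of_abs_sub_le hP.h_lipschitz

/-- Smoothing preserves `L` and `β`, so the estimates for prox-linear steps apply to `F` and to
`F^ν` with the same step size. -/
theorem Standing.smooth [ProperSpace Y] (hP : P.Standing L β) (hL : 0 ≤ L) (hν : 0 < ν) :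
    (P.smooth ν).Standing L β where
  g_pcc := hP.g_pcc
  h_convex := convexOn_moreau hP.continuous_h hP.h_convex hν
  h_lipschitz := moreau_abs_sub_le hL hP.h_lipschitz hP.h_convex hν
  c_contDiff := hP.c_contDiff
  jac_lipschitz := hP.jac_lipschitz

theorem modelReal_self (P : CompositeProblem E Y) (t : ℝ) (x : E) :
    P.modelReal t x x = P.objReal x := by
  simp [modelReal, objReal]

/-- The model majorizes the objective. -/
theorem Standing.objReal_le_modelReal (hP : P.Standing L β) (hL : 0 ≤ L) (x z : E) :
    P.objReal z ≤ P.modelReal (L * β)⁻¹ x z := by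
  have h1 := norm_sub_linearization_le (hP.c_contDiff.differentiable one_ne_zero)
    hP.jac_lipschitz x z
  have h2 := (le_abs_self _).trans (hP.h_lipschitz (P.c z) (P.c x + fderiv ℝ P.c x (z - x)))
  have h3 := mul_le_mul_of_nonneg_left h1 hL
  have e : ‖z - x‖ ^ 2 / (2 * (L * β)⁻¹) = L * (β / 2 * ‖z - x‖ ^ 2) := by
    rw [div_eq_mul_inv, mul_inv, inv_inv]
    ring
  rw [objReal, modelReal, e]
  linarith

variable [ProperSpace E]

theorem Standing.proxLinear_spec (hP : P.Standing L β) (ht : 0 < t) (x : E) :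
    (∀ z, P.model t x (P.proxLinear t x) ≤ P.model t x z) ∧ P.g (P.proxLinear t x) < ⊤ ∧
      ∀ z, P.g z < ⊤ → P.modelReal t x (P.proxLinear t x) +
        t⁻¹ / 2 * ‖z - P.proxLinear t x‖ ^ 2 ≤ P.modelReal t x z := by
  have hconv : ConvexOn ℝ Set.univ fun z => P.h (P.c x + fderiv ℝ P.c x (z - x)) := by
    have h1 := hP.h_convex.comp_affineMap
      (AffineMap.const ℝ E (P.c x - fderiv ℝ P.c x x) + (fderiv ℝ P.c x).toLinearMap.toAffineMap)
    refine h1.congr fun z _ => ?_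
    simp only [Function.comp, map_sub]
    congr 1
    simp
    abel
  have hc := hP.continuous_h
  exact hP.g_pcc.argmin_add_spec (by fun_prop) (inv_pos.2 ht) (strongConvexOn_add_norm_sq hconv t x)

/-- A step that is optimal up to `e` decreases the objective up to `e`. -/
theorem Standing.descent (hP : P.Standing L β) (hL : 0 < L) (hβ : 0 < β) {x xp : E} {e : ℝ}
    (hx : P.g x < ⊤) (hxp : P.modelReal (L * β)⁻¹ x xp ≤
      P.modelReal (L * β)⁻¹ x (P.proxLinear (L * β)⁻¹ x) + e) :
    P.objReal xp ≤ P.objReal x - L * β / 2 * ‖x - P.proxLinear (L * β)⁻¹ x‖ ^ 2 + e := by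
  have h1 := hP.objReal_le_modelReal hL.le x xp
  -- Quadratic growth of the model is tested at `x` itself, where model and objective agree.
  have h2 := (hP.proxLinear_spec (t := (L * β)⁻¹) (by positivity) x).2.2 x hx
  rw [inv_inv, modelReal_self] at h2
  linarith

/-- A near-stationary step is a near-optimal step. -/
theorem Standing.modelReal_le_of_nearStationaryStep (hP : P.Standing L β) (hL : 0 ≤ L)
    (ht : 0 < t) {η : ℝ} {x xp : E} (hxp : P.NearStationaryStep t η x xp) (hg : P.g xp < ⊤) :
    P.modelReal t x xp ≤ P.modelReal t x (P.proxLinear t x) + 2 * (L * η) := by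
  obtain ⟨ζ, hζ, hmin⟩ := hxp
  have h1 := (hP.g_pcc.toReal_add_le_iff hg (hP.proxLinear_spec ht x).2.1 _ _).1
    (hmin (P.proxLinear t x))
  -- The shift moves the model by at most `L η`. It is added at `xp` and removed at the exact
  -- minimizer, hence the factor 2.
  have key : ∀ z, |P.h (P.c x + fderiv ℝ P.c x (z - x)) -
      P.h (ζ + P.c x + fderiv ℝ P.c x (z - x))| ≤ L * η := by
    intro z
    refine (hP.h_lipschitz _ _).trans (mul_le_mul_of_nonneg_left (le_of_eq_of_le ?_ hζ) hL)
    rw [← norm_neg]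
    congr 1
    abel
  have h2 := (abs_le.1 (key xp)).2
  have h3 := (abs_le.1 (key (P.proxLinear t x))).1
  rw [modelReal, modelReal]
  linarith

/-- Each model is tested at the minimizer of the other. Adding the two growth inequalities cancels
everything except the differences `h - h_ν`, which lie between 0 and `L²ν/2`. -/
theorem Standing.norm_proxLinear_sub_smooth_sq_le [ProperSpace Y] (hP : P.Standing L β)
    (hL : 0 ≤ L) (ht : 0 < t) (hν : 0 < ν) (x : E) :
    ‖P.proxLinear t x - (P.smooth ν).proxLinear t x‖ ^ 2 ≤ t * (L ^ 2 * ν / 2) := by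
  have hPν := hP.smooth hL hν
  obtain ⟨-, hS, h1⟩ := hP.proxLinear_spec ht x
  obtain ⟨-, hSν, h2⟩ := hPν.proxLinear_spec ht x
  replace h1 := h1 _ hSν
  replace h2 := h2 _ hS
  rw [norm_sub_rev] at h1
  have h3 := moreau_le_self hP.continuous_h hP.h_convex hν
    (P.c x + fderiv ℝ P.c x (P.proxLinear t x - x))
  have h4 := self_le_moreau_add hP.h_lipschitz hP.h_convex hν
    (P.c x + fderiv ℝ P.c x ((P.smooth ν).proxLinear t x - x))
  simp only [modelReal] at h1 h2
  simp only [CompositeProblem.smooth] at h1 h2 h4 ⊢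
  rw [← inv_mul_le_iff₀ ht]
  linarith

/-- If each step decreases the smoothed objective by a multiple of the squared step length, up to
summable errors, then one of the first iterates is nearly stationary. -/
theorem Standing.exists_norm_proxGrad_le [ProperSpace Y] (hP : P.Standing L β) {Δ ε : ℝ}
    (hL : 1 ≤ L) (hβ : 1 ≤ β) (hε : 0 < ε) (hε1 : ε ≤ 1) (hΔ : 5 ≤ Δ) {x : ℕ → E} {e : ℕ → ℝ}
    (hg : ∀ k, P.g (x k) < ⊤) (hF : (Δ : EReal) = P.F (x 0) - ⨅ x, P.F x)
    (hstep : ∀ k, (P.smooth (smoothingParam L β ε)).objReal (x (k + 1)) ≤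
      (P.smooth (smoothingParam L β ε)).objReal (x k) - L * β / 4 *
        ‖x k - (P.smooth (smoothingParam L β ε)).proxLinear (L * β)⁻¹ (x k)‖ ^ 2 + e k)
    (he : ∀ n, ∑ k ∈ Finset.range n, e k ≤ 4) :
    ∃ k < ⌈32 * (L * β) * Δ / ε ^ 2⌉₊, ‖P.proxGrad (L * β)⁻¹ (x k)‖ ≤ ε := by
  have hL0 : 0 < L := by linarith
  have hβ0 : 0 < β := by linarith
  have hμ : 0 < L * β := by positivity
  have hμ1 : 1 ≤ L * β := one_le_mul_of_one_le_of_one_le hL hβ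
  have hν : 0 < smoothingParam L β ε := by
    rw [smoothingParam]
    positivity
  have hνe : L ^ 2 * smoothingParam L β ε / 2 = (L * β)⁻¹ * (ε ^ 2 / 4) := by
    rw [smoothingParam]
    field_simp
    ring
  set ν := smoothingParam L β ε with hνdef
  set N := ⌈32 * (L * β) * Δ / ε ^ 2⌉₊ with hN
  set S : E → E := (P.smooth ν).proxLinear (L * β)⁻¹ with hS
  by_contra! hcon
  -- Smoothing moves the prox-gradient by at most `ε/2`, so at least half of a value above `ε`
  -- survives.
  have hlarge : ∀ k < N, ε / 2 ≤ L * β * ‖x k - S (x k)‖ := by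
    intro k hk
    have h1 := hcon k hk
    rw [proxGrad, inv_inv, norm_smul, Real.norm_of_nonneg hμ.le] at h1
    have h2 := hP.norm_proxLinear_sub_smooth_sq_le hL0.le (inv_pos.2 hμ) hν (x k)
    rw [hνe, ← hS, norm_sub_rev] at h2
    have h3 : (L * β * ‖S (x k) - P.proxLinear (L * β)⁻¹ (x k)‖) ^ 2 ≤ (ε / 2) ^ 2 := by
      rw [mul_pow]
      have := mul_le_mul_of_nonneg_left h2 (sq_nonneg (L * β))
      refine this.trans (le_of_eq ?_)
      field_simp
      ring
    have h4 := (sq_le_sq₀ (by positivity) (by positivity)).1 h3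
    have h5 := norm_sub_le_norm_sub_add_norm_sub (x k) (S (x k)) (P.proxLinear (L * β)⁻¹ (x k))
    have h6 := mul_le_mul_of_nonneg_left h5 hμ.le
    linarith
  have hsum : ∀ n ≤ N, (P.smooth ν).objReal (x n) ≤ (P.smooth ν).objReal (x 0) -
      n * ((L * β)⁻¹ * (ε ^ 2 / 16)) + ∑ k ∈ Finset.range n, e k := by
    intro n
    induction n with
    | zero => simp
    | succ n ih =>
      intro hn
      have h1 := ih (by omega)
      have h2 := hstep n
      have h3 : (L * β)⁻¹ * (ε ^ 2 / 16) ≤ L * β / 4 * ‖x n - S (x n)‖ ^ 2 := by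
        have := pow_le_pow_left₀ (by positivity) (hlarge n (by omega)) 2
        rw [inv_mul_le_iff₀ hμ]
        nlinarith
      rw [Finset.sum_range_succ]
      push_cast
      linarith
  have hfin : ∀ k, P.F (x k) = (P.objReal (x k) : EReal) := by
    intro k
    rw [F, objReal, EReal.coe_add, hP.g_pcc.coe_toReal (hg k)]
  have hΔN : P.objReal (x 0) ≤ P.objReal (x N) + Δ := by
    have h1 : (⨅ x, P.F x) ≤ P.F (x N) := iInf_le _ _
    rw [hfin] at h1 hF
    generalize (⨅ x, P.F x) = i at h1 hF
    -- `inf F = -∞` is excluded because `Δ` is a real number.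
    induction i with
    | bot => simp at hF
    | top => simp at h1
    | coe i =>
      rw [← EReal.coe_sub, EReal.coe_eq_coe_iff] at hF
      rw [EReal.coe_le_coe_iff] at h1
      linarith
  have h1 := hsum N le_rfl
  have h2 := he N
  have h3 : 2 * Δ ≤ N * ((L * β)⁻¹ * (ε ^ 2 / 16)) := by
    have := mul_le_mul_of_nonneg_right (Nat.le_ceil (32 * (L * β) * Δ / ε ^ 2))
      (show 0 ≤ (L * β)⁻¹ * (ε ^ 2 / 16) by positivity)
    refine le_trans (le_of_eq ?_) this
    field_simp
    ring
  have h4 := moreau_le_self hP.continuous_h hP.h_convex hν (P.c (x 0))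
  have h5 := self_le_moreau_add hP.h_lipschitz hP.h_convex hν (P.c (x N))
  -- Final count: the decrease `2Δ` cannot exceed the gap `Δ`, plus 4 for the step errors, plus 1/4
  -- for smoothing; this contradicts `Δ ≥ 5`.
  have h6 : L ^ 2 * ν / 2 ≤ 1 / 4 := by
    rw [hνe]
    have : (L * β)⁻¹ ≤ 1 := inv_le_one_of_one_le₀ hμ1
    have : ε ^ 2 ≤ 1 := pow_le_one₀ hε.le hε1
    have : 0 < (L * β)⁻¹ := inv_pos.2 hμ
    nlinarith
  simp only [objReal] at h1 hΔN
  simp only [CompositeProblem.smooth] at h1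
  linarith

end

end CompositeProblem

/-! ### The conjugate of the Moreau envelope -/

section Conjugate

variable {Y : Type} [NormedAddCommGroup Y] [InnerProductSpace ℝ Y] {H : Y → ℝ}

theorem inner_sub_le_fenchelConj_toReal {w : Y} (hw : fenchelConj H w < ⊤) (y : Y) :
    inner ℝ w y - H y ≤ (fenchelConj H w).toReal := by
  have h1 : ((inner ℝ w y - H y : ℝ) : EReal) ≤ fenchelConj H w :=
    le_iSup (fun y => ((inner ℝ w y - H y : ℝ) : EReal)) y
  rw [← EReal.coe_le_coe_iff, EReal.coe_toReal hw.ne (ne_bot_of_le_ne_bot (EReal.coe_ne_bot _) h1)]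
  exact h1

theorem fenchelConj_eq_of_subgradient {w q : Y} (hw : ∀ y, H q + inner ℝ w (y - q) ≤ H y) :
    fenchelConj H w = ((inner ℝ w q - H q : ℝ) : EReal) := by
  refine le_antisymm (iSup_le fun y => ?_)
    (le_iSup (fun y => ((inner ℝ w y - H y : ℝ) : EReal)) q)
  have h1 := hw y
  rw [inner_sub_right] at h1
  rw [EReal.coe_le_coe_iff]
  linarith

/-- The conjugate of an `L`-Lipschitz function is finite only on the ball of radius `L`. -/
theorem norm_le_of_fenchelConj_lt_top {L : ℝ} (hL : ∀ y z, |H y - H z| ≤ L * ‖y - z‖)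
    {w : Y} (hL0 : 0 ≤ L) (hw : fenchelConj H w < ⊤) : ‖w‖ ≤ L := by
  by_contra! hcon
  have hw0 : 0 < ‖w‖ := lt_of_le_of_lt hL0 hcon
  set B := (fenchelConj H w).toReal + H 0 with hB
  -- Along the ray `s • w` the linear term outgrows `H` at a positive rate, so the conjugate would
  -- be infinite.
  have key : ∀ s : ℝ, 0 ≤ s → s * (‖w‖ * (‖w‖ - L)) ≤ B := by
    intro s hs
    have h1 := inner_sub_le_fenchelConj_toReal hw (s • w)
    have h2 := (le_abs_self _).trans (hL (s • w) 0)
    rw [sub_zero, norm_smul, Real.norm_of_nonneg hs] at h2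
    rw [real_inner_smul_right, real_inner_self_eq_norm_sq] at h1
    nlinarith
  have hpos : 0 < ‖w‖ * (‖w‖ - L) := mul_pos hw0 (by linarith)
  have hB0 : 0 ≤ B := by simpa using key 0 le_rfl
  have h := key ((B + 1) / (‖w‖ * (‖w‖ - L))) (by positivity)
  rw [div_mul_cancel₀ _ hpos.ne'] at h
  linarith

variable [ProperSpace Y] {h : Y → ℝ} {ν : ℝ}

theorem fenchelConj_moreau_moreauGrad (hc : Continuous h) (hconv : ConvexOn ℝ Set.univ h)
    (hν : 0 < ν) (q : Y) :
    fenchelConj (moreau ν h) (moreauGrad ν h q) =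
      ((inner ℝ (moreauGrad ν h q) q - moreau ν h q : ℝ) : EReal) :=
  fenchelConj_eq_of_subgradient (moreau_lower hc hconv hν q)

/-- The gradient `u - τ q` of `h_ν` at `q` is the proximal point `prox_{τ h_ν*}(u)`. -/
theorem isProxPoint_moreauGrad (hc : Continuous h) (hconv : ConvexOn ℝ Set.univ h)
    (hν : 0 < ν) {τ : ℝ} (hτ : 0 < τ) {u q : Y} (hq : moreauGrad ν h q = u - τ • q) :
    IsProxPoint {w | fenchelConj (moreau ν h) w < ⊤}
      (fun w => (fenchelConj (moreau ν h) w).toReal) ν τ u (moreauGrad ν h q) := by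
  have hconj := fenchelConj_moreau_moreauGrad hc hconv hν q
  refine ⟨by rw [Set.mem_ofPred_eq, hconj]; exact EReal.coe_lt_top _, fun w hw => ?_⟩
  simp only [hconj, EReal.toReal_coe]
  have huq : u - moreauGrad ν h q = τ • q := by
    rw [hq]
    abel
  rw [huq, real_inner_smul_left, inv_mul_cancel_left₀ hτ.ne']
  set v := moreauGrad ν h q with hv
  -- This point maximizes `⟨w, ·⟩` minus the quadratic upper bound of `h_ν` at `q`, which converts
  -- `ν⁻¹`-smoothness into `ν`-strong convexity of the conjugate.
  have h1 := inner_sub_le_fenchelConj_toReal hw (q + ν • (w - v))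
  have h2 := moreau_upper hc hconv hν q (q + ν • (w - v))
  rw [add_sub_cancel_left, norm_smul, mul_pow, Real.norm_of_nonneg hν.le,
    real_inner_smul_right, ← hv] at h2
  rw [inner_add_right, real_inner_smul_right] at h1
  have e1 : inner ℝ w (w - v) - inner ℝ v (w - v) = ‖w - v‖ ^ 2 := by
    rw [← inner_sub_left, real_inner_self_eq_norm_sq]
  have e2 : ν⁻¹ / 2 * (ν ^ 2 * ‖w - v‖ ^ 2) = ν / 2 * ‖w - v‖ ^ 2 := by
    field_simp
  have e3 : ν * inner ℝ w (w - v) = ν * inner ℝ v (w - v) + ν * ‖w - v‖ ^ 2 := by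
    rw [← e1]
    ring
  rw [real_inner_comm (w - v) q, inner_sub_left]
  linarith

end Conjugate

/-! ### The smooth parts of the subproblem and of its dual -/

section Subproblem

variable {E Y : Type} [NormedAddCommGroup E] [InnerProductSpace ℝ E] [ProperSpace E]
  [NormedAddCommGroup Y] [InnerProductSpace ℝ Y] [ProperSpace Y]

open ContinuousLinearMap (adjoint)

/-- The smooth part `(g + ‖· - x‖² / (2t))*(-A* w) - ⟨b - A x, w⟩` of the dual of
`min_z g(z) + H(b + A (z - x)) + ‖z - x‖² / (2t)`. -/
noncomputable def dualSmooth (g : E → EReal) (t : ℝ) (x : E) (b : Y) (A : E →L[ℝ] Y) (w : Y) : ℝ :=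
  -((g (prox t g (x - t • adjoint A w))).toReal +
      ‖prox t g (x - t • adjoint A w) - x‖ ^ 2 / (2 * t)) -
    inner ℝ w (b + A (prox t g (x - t • adjoint A w) - x))

variable {g : E → EReal} {t : ℝ}

/-- The primal point recovered from `w` minimizes the strongly convex Lagrangian. -/
theorem lagrangian_growth (hg : ProperClosedConvex g) (ht : 0 < t) (x : E) (A : E →L[ℝ] Y) (w : Y)
    {y : E} (hy : g y < ⊤) :
    (g (prox t g (x - t • adjoint A w))).toReal +
        ‖prox t g (x - t • adjoint A w) - x‖ ^ 2 / (2 * t) +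
        inner ℝ w (A (prox t g (x - t • adjoint A w) - x)) +
        t⁻¹ / 2 * ‖y - prox t g (x - t • adjoint A w)‖ ^ 2 ≤
      (g y).toReal + ‖y - x‖ ^ 2 / (2 * t) + inner ℝ w (A (y - x)) := by
  have h1 := (hg.prox_spec ht (x - t • adjoint A w)).2 y hy
  set z := prox t g (x - t • adjoint A w)
  have e1 : t⁻¹ * inner ℝ (x - t • adjoint A w - z) (y - z) =
      t⁻¹ * inner ℝ (x - z) (y - z) - inner ℝ w (A (y - z)) := by
    rw [show x - t • adjoint A w - z = (x - z) - t • adjoint A w by abel, inner_sub_left,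
      real_inner_smul_left, ContinuousLinearMap.adjoint_inner_left, mul_sub,
      inv_mul_cancel_left₀ ht.ne']
  have e2 : inner ℝ w (A (y - x)) = inner ℝ w (A (z - x)) + inner ℝ w (A (y - z)) := by
    rw [← inner_add_right, ← map_add]
    congr 2
    abel
  have e3 : ‖y - x‖ ^ 2 = ‖y - z‖ ^ 2 - 2 * inner ℝ (x - z) (y - z) + ‖z - x‖ ^ 2 := by
    rw [show y - x = (y - z) - (x - z) by abel, norm_sub_sq_real, real_inner_comm,
      norm_sub_rev z x]
  have e4 : ‖y - x‖ ^ 2 / (2 * t) = t⁻¹ / 2 * ‖y - z‖ ^ 2 - t⁻¹ * inner ℝ (x - z) (y - z) +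
      ‖z - x‖ ^ 2 / (2 * t) := by
    rw [e3]
    field_simp
  linarith

/-- Up to sign, the dual function is the minimum over `z` of a Lagrangian affine in `w`. The lower
bound uses the minimizer for `w` as a trial point for `w'`. For the upper bound, the growth `‖z' -
z‖²/(2t)` absorbs the cross term `⟨w' - w, A(z' - z)⟩` by Young's inequality, at the price `t M²/2
‖w' - w‖²`. -/
theorem smoothConvex_dualSmooth (hg : ProperClosedConvex g) (ht : 0 < t) (x : E) (b : Y)
    {A : E →L[ℝ] Y} {M : ℝ} (hA : ‖A‖ ≤ M) :
    SmoothConvex (dualSmooth g t x b A)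
      (fun w => A (x - prox t g (x - t • adjoint A w)) - b) (t * M ^ 2) := by
  have hdom : ∀ w, g (prox t g (x - t • adjoint A w)) < ⊤ := fun w => (hg.prox_spec ht _).1
  have hgrad : ∀ z, A (x - z) - b = -(b + A (z - x)) := by
    intro z
    rw [← neg_sub z x, map_neg]
    abel
  refine ⟨fun w w' => ?_, fun w w' => ?_⟩
  · have h1 := lagrangian_growth hg ht x A w' (hdom w)
    have h2 : 0 ≤ t⁻¹ / 2 * ‖prox t g (x - t • adjoint A w) -
      prox t g (x - t • adjoint A w')‖ ^ 2 := by positivity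
    simp only [dualSmooth, hgrad, inner_neg_left, real_inner_comm _ (_ + _), inner_add_right,
      inner_sub_left] at h1 h2 ⊢
    linarith
  · have h1 := lagrangian_growth hg ht x A w (hdom w')
    set z := prox t g (x - t • adjoint A w) with hz
    set z' := prox t g (x - t • adjoint A w') with hz'
    have h2 : -inner ℝ (w' - w) (A (z' - z)) ≤
        t * M ^ 2 / 2 * ‖w' - w‖ ^ 2 + t⁻¹ / 2 * ‖z' - z‖ ^ 2 := by
      have h3 := (abs_le.1 (abs_real_inner_le_norm (w' - w) (A (z' - z)))).1
      have h4 : ‖A (z' - z)‖ ≤ M * ‖z' - z‖ :=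
        (A.le_opNorm _).trans (mul_le_mul_of_nonneg_right hA (norm_nonneg _))
      have h5 := mul_le_mul_of_nonneg_left h4 (norm_nonneg (w' - w))
      have h6 : 0 ≤ t⁻¹ / 2 * (t * (M * ‖w' - w‖) - ‖z' - z‖) ^ 2 := by positivity
      have e : t⁻¹ / 2 * (t * (M * ‖w' - w‖) - ‖z' - z‖) ^ 2 =
          t * M ^ 2 / 2 * ‖w' - w‖ ^ 2 + t⁻¹ / 2 * ‖z' - z‖ ^ 2 -
            ‖w' - w‖ * (M * ‖z' - z‖) := by
        field_simp
        ring
      linarith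
    have e1 : inner ℝ (w' - w) (A (z' - z)) = inner ℝ w' (A (z' - x)) - inner ℝ w (A (z' - x)) -
        inner ℝ w' (A (z - x)) + inner ℝ w (A (z - x)) := by
      rw [show z' - z = (z' - x) - (z - x) by abel, map_sub, inner_sub_left, inner_sub_right,
        inner_sub_right]
      ring
    have e2 : inner ℝ (A (x - z) - b) (w' - w) =
        -inner ℝ w' b - inner ℝ w' (A (z - x)) + inner ℝ w b + inner ℝ w (A (z - x)) := by
      rw [hgrad, inner_neg_left, real_inner_comm, inner_sub_left, inner_add_right, inner_add_right]
      ring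
    simp only [dualSmooth, ← hz, ← hz', inner_add_right]
    rw [e2]
    linarith

theorem smoothConvex_moreau_comp {h : Y → ℝ} {ν : ℝ} (hc : Continuous h)
    (hconv : ConvexOn ℝ Set.univ h) (hν : 0 < ν) (x : E) (b : Y) {A : E →L[ℝ] Y} {M : ℝ}
    (hA : ‖A‖ ≤ M) :
    SmoothConvex (fun z => moreau ν h (b + A (z - x)))
      (fun z => adjoint A (moreauGrad ν h (b + A (z - x)))) (M ^ 2 / ν) := by
  have e : ∀ y z : E, b + A (z - x) - (b + A (y - x)) = A (z - y) := by
    intro y z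
    rw [add_sub_add_left_eq_sub, ← map_sub]
    congr 1
    abel
  refine ⟨fun y z => ?_, fun y z => ?_⟩
  · have h1 := moreau_lower hc hconv hν (b + A (y - x)) (b + A (z - x))
    rwa [e, ← ContinuousLinearMap.adjoint_inner_left] at h1
  · have h1 := moreau_upper hc hconv hν (b + A (y - x)) (b + A (z - x))
    rw [e, ← ContinuousLinearMap.adjoint_inner_left] at h1
    refine h1.trans (add_le_add_right ?_ _)
    have h2 : ‖A (z - y)‖ ≤ M * ‖z - y‖ :=
      (A.le_opNorm _).trans (mul_le_mul_of_nonneg_right hA (norm_nonneg _))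
    calc ν⁻¹ / 2 * ‖A (z - y)‖ ^ 2 ≤ ν⁻¹ / 2 * (M * ‖z - y‖) ^ 2 := by gcongr
      _ = M ^ 2 / ν / 2 * ‖z - y‖ ^ 2 := by
        field_simp

/-- The proximal map of `g + ‖· - x‖² / (2t)` in terms of that of `g`. -/
theorem isProxPoint_add_norm_sq (hg : ProperClosedConvex g) (ht : 0 < t) (x : E) {τ : ℝ}
    (hτ : 0 < τ) (u : E) :
    IsProxPoint {z | g z < ⊤} (fun z => (g z).toReal + ‖z - x‖ ^ 2 / (2 * t)) t⁻¹ τ u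
      (prox (t * τ / (t + τ)) g ((t + τ)⁻¹ • (τ • x + t • u))) := by
  obtain ⟨h1, h2⟩ := hg.prox_spec (show 0 < t * τ / (t + τ) by positivity)
    ((t + τ)⁻¹ • (τ • x + t • u))
  refine ⟨h1, fun z hz => ?_⟩
  have h3 := h2 z hz
  set q := prox (t * τ / (t + τ)) g ((t + τ)⁻¹ • (τ • x + t • u))
  have e1 : (t * τ / (t + τ))⁻¹ * inner ℝ ((t + τ)⁻¹ • (τ • x + t • u) - q) (z - q) =
      t⁻¹ * inner ℝ (x - q) (z - q) + τ⁻¹ * inner ℝ (u - q) (z - q) := by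
    simp only [← real_inner_smul_left, ← inner_add_left]
    congr 1
    match_scalars <;> field_simp
    ring
  have e2 : ‖z - x‖ ^ 2 = ‖z - q‖ ^ 2 - 2 * inner ℝ (x - q) (z - q) + ‖q - x‖ ^ 2 := by
    rw [show z - x = (z - q) - (x - q) by abel, norm_sub_sq_real, real_inner_comm,
      norm_sub_rev q x]
  have e3 : ‖z - x‖ ^ 2 / (2 * t) = t⁻¹ / 2 * ‖z - q‖ ^ 2 - t⁻¹ * inner ℝ (x - q) (z - q) +
      ‖q - x‖ ^ 2 / (2 * t) := by
    rw [e2]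
    field_simp
  simp only
  linarith

end Subproblem

/-- A prox-gradient step from a point that is optimal up to `η² / (8 l)` gives a subgradient of
norm at most `η`. -/
theorem norm_proxGradient_subgradient_le {X : Type} [NormedAddCommGroup X] [InnerProductSpace ℝ X]
    {D : Set X} {f p : X → ℝ} {f' : X → X} {α l η : ℝ} (hf : SmoothConvex f f' l) (hl : 0 < l)
    (hα : 0 ≤ α) (hη : 0 ≤ η) {s w : X} (hs : s ∈ D) (hw : IsProxPoint D p α l⁻¹ (s - l⁻¹ • f' s) w)
    (hgap : f s + p s ≤ f w + p w + η ^ 2 / (8 * l)) :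
    ‖l • (s - w) + (f' w - f' s)‖ ≤ η := by
  have h1 := hw.2 s hs
  have h2 := hf.upper s w
  have h3 : 0 ≤ α / 2 * ‖s - w‖ ^ 2 := by positivity
  have e1 : l⁻¹⁻¹ * inner ℝ (s - l⁻¹ • f' s - w) (s - w) =
      l * ‖s - w‖ ^ 2 - inner ℝ (f' s) (s - w) := by
    rw [show s - l⁻¹ • f' s - w = (s - w) - l⁻¹ • f' s by abel, inner_sub_left,
      real_inner_smul_left, real_inner_self_eq_norm_sq, inv_inv, mul_sub,
      mul_inv_cancel_left₀ hl.ne']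
  rw [e1] at h1
  rw [norm_sub_rev w s, ← neg_sub s w, inner_neg_right] at h2
  -- The prox-gradient step decreases the objective by at least `l/2 ‖s - w‖²`. Hence `l ‖s - w‖ ≤
  -- η/2`, which bounds each of the two summands.
  have h4 : l / 2 * ‖s - w‖ ^ 2 ≤ η ^ 2 / (8 * l) := by linarith
  have h5 : (2 * l * ‖s - w‖) ^ 2 ≤ η ^ 2 := by
    rw [le_div_iff₀ (by positivity)] at h4
    nlinarith
  have h6 := (sq_le_sq₀ (by positivity) hη).1 h5
  have h7 := hf.grad_lipschitz hl s w
  rw [norm_sub_rev w s] at h7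
  have h8 := norm_add_le (l • (s - w)) (f' w - f' s)
  rw [norm_smul, Real.norm_of_nonneg hl.le] at h8
  linarith

/-! ### One outer step -/

theorem le_pow_dualCount {L α l η : ℝ} (hL : 0 < L) (hα : 0 < α) (hl : 0 < l) (hη : 0 < η) :
    8 * l ^ 2 * L ^ 2 / η ^ 2 ≤ ((1 + √(α / (2 * l))) ^ 2) ^ (dualCount L α l η - 1) := by
  set σ := √(α / (2 * l)) with hσ
  have hσ0 : 0 < σ := Real.sqrt_pos.2 (by positivity)
  have hlog : 0 < Real.log (1 + σ) := Real.log_pos (by linarith)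
  have hX : 0 < 8 * l ^ 2 * L ^ 2 / η ^ 2 := by positivity
  rw [← Real.log_le_log_iff hX (by positivity), Real.log_pow, Real.log_pow, dualCount,
    Nat.add_sub_cancel_left, ← hσ]
  have h1 := Nat.le_ceil (Real.log (8 * l ^ 2 * L ^ 2 / η ^ 2) / (2 * Real.log (1 + σ)))
  rw [div_le_iff₀ (by positivity)] at h1
  exact h1

/-- With `r = (1 + σ)²` one has `4tγ = t l r` and `τ = 1 - 1/r ≤ log r`, so the count forces `t l r
≤ r^T`; one factor `r` cancels. -/
theorem le_pow_primalCount {t α l : ℝ} (ht : 0 < t) (hα : 0 < α) (hl : 0 < l) :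
    t * l ≤ ((1 + √(α / (2 * l))) ^ 2) ^ (primalCount t α l - 1) := by
  set σ := √(α / (2 * l)) with hσ
  have hσ0 : 0 < σ := Real.sqrt_pos.2 (by positivity)
  set r := (1 + σ) ^ 2 with hr
  have hr1 : 1 < r := by
    rw [hr]
    nlinarith
  have hr0 : 0 < r := by linarith
  have hτ : 0 < 1 - r⁻¹ := sub_pos.2 (inv_lt_one_of_one_lt₀ hr1)
  have hT1 : 1 ≤ primalCount t α l := le_max_left _ _
  have hT : (1 - r⁻¹)⁻¹ * Real.log (4 * t * (r * (l / 4))) ≤ primalCount t α l := by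
    refine (Nat.le_ceil _).trans ?_
    exact_mod_cast le_max_right _ _
  rw [inv_mul_le_iff₀ hτ] at hT
  have hlog : 1 - r⁻¹ ≤ Real.log r := Real.one_sub_inv_le_log_of_pos hr0
  have hX : 0 < 4 * t * (r * (l / 4)) := by positivity
  have h1 : 4 * t * (r * (l / 4)) ≤ r ^ primalCount t α l := by
    rw [← Real.log_le_log_iff hX (by positivity), Real.log_pow]
    have := mul_le_mul_of_nonneg_right hlog (Nat.cast_nonneg (α := ℝ) (primalCount t α l))
    linarith
  obtain ⟨n, hn⟩ : ∃ n, primalCount t α l = n + 1 := ⟨primalCount t α l - 1, by omega⟩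
  rw [hn, pow_succ] at h1
  rw [hn, Nat.add_sub_cancel]
  refine le_of_mul_le_mul_right ?_ hr0
  linarith

section Steps

variable {E Y : Type} [NormedAddCommGroup E] [InnerProductSpace ℝ E] [ProperSpace E]
  [NormedAddCommGroup Y] [InnerProductSpace ℝ Y] [ProperSpace Y]

open ContinuousLinearMap (adjoint)

variable {P : CompositeProblem E Y} {L β t ν η M : ℝ}

theorem run_dualGrad (t : ℝ) (x : E) (b w : Y) :
    (dualGrad t x b w).run P =
      (fderiv ℝ P.c x (x - prox t P.g (x - t • adjoint (fderiv ℝ P.c x) w)) - b, 3) := by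
  ext <;> simp [dualGrad]

theorem run_dualProx_snd (ν τ : ℝ) (w : Y) : ((dualProx ν τ w : Prog E Y Y).run P).2 = 1 := by
  simp [dualProx, envProx]

/-- The dual proximal point is the gradient of `h_ν` at some `q`. -/
theorem exists_moreauGrad_eq_dualProx (hc : Continuous P.h) (hconv : ConvexOn ℝ Set.univ P.h)
    (hν : 0 < ν) {τ : ℝ} (hτ : 0 < τ) (u : Y) :
    ∃ q, ((dualProx ν τ u : Prog E Y Y).run P).1 = moreauGrad ν P.h q ∧
      moreauGrad ν P.h q = u - τ • q := by
  simp only [dualProx, envProx, Prog.run_bind_fst, Prog.run_pure, Prog.run_askProxH]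
  have h1 := moreauGrad_env_prox hc hconv hν (inv_pos.2 hτ) (y := τ⁻¹ • u) rfl
  set q := (ν / (τ⁻¹ + ν)) • τ⁻¹ • u +
    (τ⁻¹ / (τ⁻¹ + ν)) • prox (τ⁻¹ + ν) (fun z => (P.h z : EReal)) (τ⁻¹ • u)
  have h2 : moreauGrad ν P.h q = u - τ • q := by
    rw [h1, inv_inv, smul_sub, smul_inv_smul₀ hτ.ne']
  exact ⟨q, h2.symm, h2⟩

theorem isProxPoint_dualProx (hc : Continuous P.h) (hconv : ConvexOn ℝ Set.univ P.h)
    (hν : 0 < ν) {τ : ℝ} (hτ : 0 < τ) (u : Y) :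
    IsProxPoint {w | fenchelConj (moreau ν P.h) w < ⊤}
      (fun w => (fenchelConj (moreau ν P.h) w).toReal) ν τ u
      ((dualProx ν τ u : Prog E Y Y).run P).1 := by
  obtain ⟨q, h1, h2⟩ := exists_moreauGrad_eq_dualProx hc hconv hν hτ u
  rw [h1]
  exact isProxPoint_moreauGrad hc hconv hν hτ h2

/-- The recovered primal point solves the subproblem shifted by the dual subgradient
`q + ∇f(w)`, where `w = ∇h_ν(q)`. -/
theorem shiftedModel_recovered_le (hP : P.Standing L β) (ht : 0 < t) (hν : 0 < ν) (x : E) {q w : Y}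
    (hw : w = moreauGrad ν P.h q) {xp : E}
    (hxp : xp = prox t P.g (x - t • adjoint (fderiv ℝ P.c x) w)) (z : E) :
    (P.smooth ν).shiftedModel t (q + (fderiv ℝ P.c x (x - xp) - P.c x)) x xp ≤
      (P.smooth ν).shiftedModel t (q + (fderiv ℝ P.c x (x - xp) - P.c x)) x z := by
  have hg := hP.g_pcc
  have hxpt : P.g xp < ⊤ := hxp ▸ (hg.prox_spec ht _).1
  simp only [CompositeProblem.shiftedModel, CompositeProblem.smooth]
  by_cases hz : P.g z < ⊤
  swap
  · rw [not_lt_top_iff.1 hz, EReal.top_add_coe]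
    exact le_top
  rw [hg.toReal_add_le_iff hxpt hz]
  have h1 := lagrangian_growth hg ht x (fderiv ℝ P.c x) w hz
  rw [← hxp] at h1
  -- The shift places the argument of `h_ν` at `xp` exactly at `q`, where its gradient is `w`.
  -- Minimality is then the Lagrangian inequality plus the gradient inequality at `q`.
  have e : ∀ y, q + (fderiv ℝ P.c x (x - xp) - P.c x) + P.c x + fderiv ℝ P.c x (y - x) =
      q + fderiv ℝ P.c x (y - xp) := by
    intro y
    rw [show y - xp = (x - xp) + (y - x) by abel, map_add]
    abel
  have h2 := moreau_lower hP.continuous_h hP.h_convex hν q (q + fderiv ℝ P.c x (z - xp))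
  have h3 : 0 ≤ t⁻¹ / 2 * ‖z - xp‖ ^ 2 := by positivity
  rw [add_sub_cancel_left, ← hw] at h2
  have e2 : inner ℝ w (fderiv ℝ P.c x (z - xp)) =
      inner ℝ w (fderiv ℝ P.c x (z - x)) - inner ℝ w (fderiv ℝ P.c x (xp - x)) := by
    rw [← inner_sub_right, ← map_sub]
    congr 2
    abel
  rw [e, e, sub_self, map_zero, add_zero]
  linarith

theorem dualStep_spec (hP : P.Standing L β) (hL : 0 < L) (ht : 0 < t) (hν : 0 < ν) (hη : 0 < η)
    (hM : 0 < M) {x : E} (hA : ‖fderiv ℝ P.c x‖ ≤ M) {w₀ : Y}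
    (hw₀ : fenchelConj (moreau ν P.h) w₀ < ⊤) :
    (P.smooth ν).NearStationaryStep t η x ((dualStep L t ν η M w₀ x).run P).1 ∧
      P.g ((dualStep L t ν η M w₀ x).run P).1 < ⊤ := by
  have hl : 0 < t * M ^ 2 := by positivity
  have hc := hP.continuous_h
  have hf := smoothConvex_dualSmooth hP.g_pcc ht x (P.c x) hA
  have hprox : ∀ τ, 0 < τ → ∀ u, IsProxPoint {w | fenchelConj (moreau ν P.h) w < ⊤}
      (fun w => (fenchelConj (moreau ν P.h) w).toReal) ν τ u
      ((dualProx ν τ u : Prog E Y Y).run P).1 :=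
    fun τ hτ u => isProxPoint_dualProx hc hP.h_convex hν hτ u
  have hrate := fastGradient_rate (P := P) (grad := dualGrad t x (P.c x)) hf hl hν.le
    (fun w => by rw [run_dualGrad]) hprox w₀ (T := dualCount L ν (t * M ^ 2) η)
    (Nat.le_add_right 1 _)
  have hpow := le_pow_dualCount hL hν hl hη
  simp only [dualStep, Prog.run_bind_fst, Prog.run_askC, Prog.run_askJacAdj, Prog.run_askProxG,
    run_dualGrad]
  set l := t * M ^ 2
  set s := ((fastGradient (dualGrad t x (P.c x)) (dualProx ν) ν l w₀
    (dualCount L ν l η)).run P).1.x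
  obtain ⟨q, hq1, hq2⟩ := exists_moreauGrad_eq_dualProx (E := E) hc hP.h_convex hν (inv_pos.2 hl)
    (s - l⁻¹ • (fderiv ℝ P.c x (x - prox t P.g (x - t • adjoint (fderiv ℝ P.c x) s)) - P.c x))
  have hw := hprox _ (inv_pos.2 hl)
    (s - l⁻¹ • (fderiv ℝ P.c x (x - prox t P.g (x - t • adjoint (fderiv ℝ P.c x) s)) - P.c x))
  set w := ((dualProx ν l⁻¹ (s - l⁻¹ • (fderiv ℝ P.c x (x - prox t P.g
    (x - t • adjoint (fderiv ℝ P.c x) s)) - P.c x)) : Prog E Y Y).run P).1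
  refine ⟨⟨_, ?_, shiftedModel_recovered_le hP ht hν x hq1 rfl⟩, (hP.g_pcc.prox_spec ht _).1⟩
  -- The rate is applied against the output `w` of the extra prox-gradient step, so no dual
  -- minimizer is needed.
  have hgap := hrate.2 w hw.1
  have hnorm : ∀ v, fenchelConj (moreau ν P.h) v < ⊤ → ‖v‖ ≤ L := fun v hv =>
    norm_le_of_fenchelConj_lt_top (moreau_abs_sub_le hL.le hP.h_lipschitz hP.h_convex hν) hL.le hv
  have hdist : ‖w - w₀‖ ≤ 2 * L := by
    have := norm_sub_le w w₀
    linarith [hnorm w hw.1, hnorm w₀ hw₀]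
  have hsub := norm_proxGradient_subgradient_le hf hl hν.le hη.le hrate.1 hw (by
    refine hgap.trans (add_le_add_right ?_ _)
    set Q := ((1 + √(ν / (2 * l))) ^ 2) ^ (dualCount L ν l η - 1)
    have hQ : 0 < Q := by positivity
    calc l / 4 * Q⁻¹ * ‖w - w₀‖ ^ 2 ≤ l / 4 * Q⁻¹ * (2 * L) ^ 2 := by gcongr
      _ = l * L ^ 2 * Q⁻¹ := by ring
      _ ≤ l * L ^ 2 * (8 * l ^ 2 * L ^ 2 / η ^ 2)⁻¹ := by gcongr
      _ = η ^ 2 / (8 * l) := by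
        field_simp)
  -- This identifies the shift `q + ∇f(w)` with the subgradient bounded in `hsub`.
  have hqeq : q = l • (s - w) -
      (fderiv ℝ P.c x (x - prox t P.g (x - t • adjoint (fderiv ℝ P.c x) s)) - P.c x) := by
    rw [← hq1] at hq2
    generalize fderiv ℝ P.c x (x - prox t P.g (x - t • adjoint (fderiv ℝ P.c x) s)) - P.c x = d
      at hq2 ⊢
    rw [hq2, smul_sub, smul_sub, smul_sub, smul_inv_smul₀ hl.ne', smul_inv_smul₀ hl.ne']
    abel
  refine le_of_eq_of_le (congrArg _ ?_) hsub
  rw [hqeq]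
  abel

theorem dualStep_cost (w₀ : Y) (x : E) :
    ((dualStep L t ν η M w₀ x).run P).2 = 8 * dualCount L ν (t * M ^ 2) η + 7 := by
  simp only [dualStep, Prog.run_bind_snd, Prog.run_askC, Prog.run_askJacAdj, Prog.run_askProxG,
    run_dualGrad, run_dualProx_snd]
  rw [fastGradient_cost (fun y => by rw [run_dualGrad]) (fun τ u => run_dualProx_snd ν τ u)]
  ring

theorem run_primalGrad (ν : ℝ) (x : E) (b : Y) (z : E) :
    (primalGrad ν x b z).run P =
      (adjoint (fderiv ℝ P.c x) (moreauGrad ν P.h (b + fderiv ℝ P.c x (z - x))), 3) := by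
  ext1 <;> simp [primalGrad, moreauGrad]

/-- The method starts at `x` and is compared with the exact step `S`, so its error bound already
carries the factor `‖S - x‖²` of the tolerance. It remains to have `(1 + σ)^(2(T-1)) ≥ t L_f`, which
the count guarantees. -/
theorem primalStep_spec (hP : P.Standing L β) (hL : 0 < L) (ht : 0 < t) (hν : 0 < ν)
    (hM : 0 < M) {x : E} (hA : ‖fderiv ℝ P.c x‖ ≤ M) :
    (P.smooth ν).NearOptimalStep t (t⁻¹ / 4 * ‖x - (P.smooth ν).proxLinear t x‖ ^ 2) x
        ((primalStep (Y := Y) t ν M x).run P).1 ∧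
      P.g ((primalStep (Y := Y) t ν M x).run P).1 < ⊤ := by
  have hl : 0 < M ^ 2 / ν := by positivity
  have hg := hP.g_pcc
  have hf := smoothConvex_moreau_comp hP.continuous_h hP.h_convex hν x (P.c x) hA
  have hrate := fastGradient_rate (P := P) (grad := primalGrad ν x (P.c x))
    (proxp := primalProx t x) hf hl (inv_pos.2 ht).le (fun z => by rw [run_primalGrad])
    (fun τ hτ u => isProxPoint_add_norm_sq hg ht x hτ u) x
    (T := primalCount t t⁻¹ (M ^ 2 / ν)) (le_max_left _ _)
  have hpow := le_pow_primalCount ht (inv_pos.2 ht) hl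
  simp only [primalStep, Prog.run_bind_fst, Prog.run_askC, Prog.run_pure]
  set l := M ^ 2 / ν
  set s := ((fastGradient (primalGrad ν x (P.c x)) (primalProx t x) t⁻¹ l x
    (primalCount t t⁻¹ l)).run P).1.x
  refine ⟨fun z => ?_, hrate.1⟩
  obtain ⟨hmin, hS, -⟩ := (hP.smooth hL.le hν).proxLinear_spec ht x
  refine le_trans ?_ (add_le_add_left (hmin z) _)
  set S := (P.smooth ν).proxLinear t x
  have h1 := hrate.2 S hS
  have h2 : l / 4 * (((1 + √(t⁻¹ / (2 * l))) ^ 2) ^ (primalCount t t⁻¹ l - 1))⁻¹ * ‖S - x‖ ^ 2 ≤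
      t⁻¹ / 4 * ‖x - S‖ ^ 2 := by
    rw [norm_sub_rev]
    refine mul_le_mul_of_nonneg_right ?_ (sq_nonneg _)
    calc _ ≤ l / 4 * (t * l)⁻¹ := by gcongr
      _ = t⁻¹ / 4 := by
        field_simp
  simp only [CompositeProblem.model]
  rw [add_assoc, ← EReal.coe_add]
  refine (hg.toReal_add_le_iff hrate.1 hS _ _).2 ?_
  simp only [CompositeProblem.smooth]
  linarith

theorem primalStep_cost (x : E) :
    ((primalStep (Y := Y) t ν M x).run P).2 = 8 * primalCount t t⁻¹ (M ^ 2 / ν) + 1 := by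
  simp only [primalStep, Prog.run_bind_snd, Prog.run_askC, Prog.run_pure]
  rw [fastGradient_cost (fun y => by rw [run_primalGrad]) (fun τ u => by
    rw [primalProx, Prog.run_askProxG])]
  ring

end Steps

/-! ### Bounds on the number of inner iterations -/

section Counts

variable {L β M Δ ε m : ℝ}

theorem ceil_div_le {a b A B : ℝ} (haA : a ≤ A) (hA : 0 ≤ A) (hB : 0 < B) (hBb : B ≤ b) :
    (⌈a / b⌉₊ : ℝ) ≤ A / B + 1 := by
  have h1 : (⌈a / b⌉₊ : ℝ) ≤ ⌈A / B⌉₊ := by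
    exact_mod_cast Nat.ceil_le_ceil (div_le_div₀ hA haA hB hBb)
  exact h1.trans (Nat.ceil_lt_add_one (div_nonneg hA hB.le)).le

theorem half_le_log_one_add {x : ℝ} (hx : 0 ≤ x) (hx1 : x ≤ 1) : x / 2 ≤ Real.log (1 + x) := by
  refine le_trans ?_ (Real.one_sub_inv_le_log_of_pos (by linarith : 0 < 1 + x))
  have : 1 - (1 + x)⁻¹ = x / (1 + x) := by
    field_simp
    ring
  rw [this]
  exact div_le_div_of_nonneg_left hx (by linarith) (by linarith)

/-- The outer iteration count is at most `33 L β Δ / ε²`. -/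
theorem outer_count_le (hL : 1 ≤ L) (hβ : 1 ≤ β) (hΔ : 1 ≤ Δ) (hε : 0 < ε) (hε1 : ε ≤ 1) :
    (⌈32 * (L * β) * Δ / ε ^ 2⌉₊ : ℝ) ≤ 33 * (L * β * Δ / ε ^ 2) := by
  have h0 : 0 ≤ 32 * (L * β) * Δ / ε ^ 2 := by positivity
  have h1 := (Nat.ceil_lt_add_one h0).le
  have h2 : 1 ≤ L * β * Δ / ε ^ 2 := by
    rw [one_le_div (by positivity)]
    calc ε ^ 2 ≤ 1 := pow_le_one₀ hε.le hε1
      _ ≤ L * β * Δ := one_le_mul_of_one_le_of_one_le (one_le_mul_of_one_le_of_one_le hL hβ) hΔ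
  have e : 32 * (L * β) * Δ / ε ^ 2 = 32 * (L * β * Δ / ε ^ 2) := by ring
  linarith

/-- Both subsolves have the same condition number: `α/L_f` is `ν/(t m²)` in the dual and in the
primal. -/
theorem sqrt_dual_ratio (hL : 0 < L) (hβ : 0 < β) (hε : 0 < ε) (hm : 0 < m) :
    √(smoothingParam L β ε / (2 * ((L * β)⁻¹ * m ^ 2))) = ε / (2 * L * m) := by
  have : smoothingParam L β ε / (2 * ((L * β)⁻¹ * m ^ 2)) = (ε / (2 * L * m)) ^ 2 := by
    rw [smoothingParam]
    field_simp
  rw [this, Real.sqrt_sq (by positivity)]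

theorem sqrt_primal_ratio (hL : 0 < L) (hβ : 0 < β) (hε : 0 < ε) (hm : 0 < m) :
    √((L * β)⁻¹⁻¹ / (2 * (m ^ 2 / smoothingParam L β ε))) = ε / (2 * L * m) := by
  have : (L * β)⁻¹⁻¹ / (2 * (m ^ 2 / smoothingParam L β ε)) = (ε / (2 * L * m)) ^ 2 := by
    rw [smoothingParam, inv_inv]
    field_simp
  rw [this, Real.sqrt_sq (by positivity)]

theorem dualCount_le (hL : 10 ≤ L) (hβ : 10 ≤ β) (hΔ : 10 ≤ Δ) (hM : 10 ≤ M) (hε : 0 < ε)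
    (hε1 : ε ≤ 1 / 10) (hm : 0 < m) (hmM : m ≤ M) {n : ℕ} (hn : 0 < n)
    (hnN : (n : ℝ) ≤ 33 * (L * β * Δ / ε ^ 2)) :
    8 * (dualCount L (smoothingParam L β ε) ((L * β)⁻¹ * m ^ 2) (dualTol L n) : ℝ) + 7 ≤
      57 * (M * L / ε * Real.log (M ^ 2 * L ^ 3 * β * Δ ^ 2 / ε ^ 4)) := by
  have hL0 : 0 < L := by linarith
  have hβ0 : 0 < β := by linarith
  have hΔ0 : 0 < Δ := by linarith
  have hM0 : 0 < M := by linarith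
  have hn0 : (0 : ℝ) < n := by exact_mod_cast hn
  set Q := M ^ 2 * L ^ 3 * β * Δ ^ 2 / ε ^ 4 with hQ
  set R := M * L / ε with hR
  -- Twelve factors of at least 10, needed to absorb the numerical constant `8 · 33⁴` below.
  have hQ12 : (10 : ℝ) ^ 12 ≤ Q := by
    rw [hQ, le_div_iff₀ (by positivity)]
    calc (10 : ℝ) ^ 12 * ε ^ 4 ≤ 10 ^ 12 * (1 / 10) ^ 4 := by gcongr
      _ = 10 ^ 2 * 10 ^ 3 * 10 * 10 ^ 2 * 1 := by norm_num
      _ ≤ M ^ 2 * L ^ 3 * β * Δ ^ 2 * 1 := by gcongr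
      _ = _ := by ring
  have hQ0 : 0 < Q := by positivity
  have hR1 : 1 ≤ R := by
    rw [hR, one_le_div hε]
    nlinarith
  have hlogQ : 1 ≤ Real.log Q := by
    rw [Real.le_log_iff_exp_le hQ0]
    have := Real.exp_one_lt_d9
    linarith
  have hX : Real.log (8 * ((L * β)⁻¹ * m ^ 2) ^ 2 * L ^ 2 / dualTol L n ^ 2) ≤ 3 * Real.log Q := by
    have e : 8 * ((L * β)⁻¹ * m ^ 2) ^ 2 * L ^ 2 / dualTol L n ^ 2 =
        8 * m ^ 4 * L ^ 2 * (n : ℝ) ^ 4 / β ^ 2 := by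
      rw [dualTol]
      field_simp
    -- The tolerance shrinks only polynomially in `n`. Inserting the outer count for `n` gives a
    -- multiple of `Q²`, so shrinking tolerances cost a constant multiple of `log Q`.
    have h1 : 8 * m ^ 4 * L ^ 2 * (n : ℝ) ^ 4 / β ^ 2 ≤ Q ^ 3 := by
      calc 8 * m ^ 4 * L ^ 2 * (n : ℝ) ^ 4 / β ^ 2
          ≤ 8 * M ^ 4 * L ^ 2 * (33 * (L * β * Δ / ε ^ 2)) ^ 4 / β ^ 2 := by gcongr
        _ = 9487368 * Q ^ 2 := by
          rw [hQ]
          field_simp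
          ring
        _ ≤ Q * Q ^ 2 := by
          gcongr
          linarith
        _ = Q ^ 3 := by ring
    rw [e, show (3 : ℝ) * Real.log Q = Real.log (Q ^ 3) by simp [Real.log_pow]]
    exact Real.log_le_log (by positivity) h1
  have hσ1 : ε / (2 * L * M) ≤ 1 := by
    rw [div_le_one (by positivity)]
    nlinarith
  -- A smaller Jacobian bound only improves `σ`, so `m` may be replaced by `M`.
  have hlog : R⁻¹ / 2 ≤ 2 * Real.log (1 + ε / (2 * L * m)) := by
    have h1 := half_le_log_one_add (x := ε / (2 * L * M)) (by positivity) hσ1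
    have h2 : Real.log (1 + ε / (2 * L * M)) ≤ Real.log (1 + ε / (2 * L * m)) :=
      Real.log_le_log (by positivity) (by gcongr)
    have e : R⁻¹ / 2 = 2 * (ε / (2 * L * M) / 2) := by
      rw [hR]
      field_simp
    linarith
  have hceil := ceil_div_le hX (by linarith) (by positivity : 0 < R⁻¹ / 2) hlog
  rw [dualCount, sqrt_dual_ratio hL0 hβ0 hε hm]
  push_cast
  have e : 3 * Real.log Q / (R⁻¹ / 2) = 6 * (R * Real.log Q) := by
    field_simp
    ring
  rw [e] at hceil
  have hRQ : 1000 * 1 ≤ R * Real.log Q := by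
    refine mul_le_mul ?_ hlogQ zero_le_one (by linarith)
    rw [hR, le_div_iff₀ hε]
    nlinarith
  linarith

theorem primalCount_le (hL : 10 ≤ L) (hβ : 10 ≤ β) (hM : 10 ≤ M) (hε : 0 < ε)
    (hε1 : ε ≤ 1 / 10) (hm : 0 < m) (hmM : m ≤ M) :
    8 * (primalCount (L * β)⁻¹ (L * β)⁻¹⁻¹ (m ^ 2 / smoothingParam L β ε) : ℝ) + 1 ≤
      57 * (M * L / ε * Real.log (M * L / ε)) := by
  have hL0 : 0 < L := by linarith
  have hβ0 : 0 < β := by linarith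
  have hM0 : 0 < M := by linarith
  set R := M * L / ε with hR
  have hR1 : 1000 ≤ R := by
    rw [hR, le_div_iff₀ hε]
    nlinarith
  have hR0 : 0 < R := by linarith
  have hlogR : 1 ≤ Real.log R := by
    rw [Real.le_log_iff_exp_le hR0]
    have := Real.exp_one_lt_d9
    linarith
  have hν : 0 < smoothingParam L β ε := by
    rw [smoothingParam]
    positivity
  have hσ : 0 < ε / (2 * L * m) := by positivity
  have hX : Real.log (4 * (L * β)⁻¹ * ((1 + ε / (2 * L * m)) ^ 2 *
      (m ^ 2 / smoothingParam L β ε / 4))) ≤ 3 * Real.log R := by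
    -- Here `β` cancels, and no distance or tolerance enters; this is why the primal logarithm
    -- involves only `M L / ε`.
    have e : 4 * (L * β)⁻¹ * ((1 + ε / (2 * L * m)) ^ 2 * (m ^ 2 / smoothingParam L β ε / 4)) =
        2 * L ^ 2 * (m + ε / (2 * L)) ^ 2 / ε ^ 2 := by
      rw [smoothingParam]
      field_simp
    have h0 : ε / (2 * L) ≤ M := by
      rw [div_le_iff₀ (by positivity)]
      nlinarith
    have h1 : 2 * L ^ 2 * (m + ε / (2 * L)) ^ 2 / ε ^ 2 ≤ R ^ 3 := by
      calc 2 * L ^ 2 * (m + ε / (2 * L)) ^ 2 / ε ^ 2 ≤ 2 * L ^ 2 * (M + M) ^ 2 / ε ^ 2 := by gcongr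
        _ = 8 * R ^ 2 := by
          rw [hR]
          field_simp
          ring
        _ ≤ R * R ^ 2 := by
          gcongr
          linarith
        _ = R ^ 3 := by ring
    rw [e, show (3 : ℝ) * Real.log R = Real.log (R ^ 3) by simp [Real.log_pow]]
    exact Real.log_le_log (by positivity) h1
  -- With `s = 1/(2R) ≤ σ`, the right side is at least `1 - 1/(1 + 2s)`, which is at least `s`
  -- because `s ≤ 1/2`.
  have hτ : R⁻¹ / 2 ≤ 1 - ((1 + ε / (2 * L * m)) ^ 2)⁻¹ := by
    have hσ1 : R⁻¹ / 2 ≤ ε / (2 * L * m) := by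
      have : R⁻¹ / 2 = ε / (2 * L * M) := by
        rw [hR]
        field_simp
      rw [this]
      gcongr
    have hs0 : 0 < R⁻¹ / 2 := by positivity
    have hs1 : R⁻¹ / 2 ≤ 1 / 2 := by
      have := inv_le_one_of_one_le₀ (by linarith : 1 ≤ R)
      linarith
    set s := R⁻¹ / 2
    have h1 : (1 + 2 * s) ≤ (1 + ε / (2 * L * m)) ^ 2 := by nlinarith
    have h2 : ((1 + ε / (2 * L * m)) ^ 2)⁻¹ ≤ (1 + 2 * s)⁻¹ :=
      inv_anti₀ (by positivity) h1
    have h3 : (1 + 2 * s)⁻¹ ≤ 1 - s := by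
      rw [inv_le_iff_one_le_mul₀ (by positivity)]
      nlinarith
    linarith
  have hceil := ceil_div_le hX (by linarith) (by positivity : 0 < R⁻¹ / 2) hτ
  have e : 3 * Real.log R / (R⁻¹ / 2) = 6 * (R * Real.log R) := by
    field_simp
    ring
  rw [e] at hceil
  have hRR : 1000 * 1 ≤ R * Real.log R := mul_le_mul hR1 hlogR zero_le_one (by linarith)
  have hcount : (primalCount (L * β)⁻¹ (L * β)⁻¹⁻¹ (m ^ 2 / smoothingParam L β ε) : ℝ) ≤
      6 * (R * Real.log R) + 1 := by
    simp only [primalCount]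
    rw [sqrt_primal_ratio hL0 hβ0 hε hm, inv_mul_eq_div, Nat.cast_max]
    refine max_le ?_ hceil
    push_cast
    linarith
  linarith

/-- Comparison with the telescoping sum of `4/(k+1) - 4/(k+2)`. -/
theorem sum_two_div_sq_le (n : ℕ) : ∑ k ∈ Finset.range n, 2 / ((k : ℝ) + 1) ^ 2 ≤ 4 := by
  have key : ∑ k ∈ Finset.range n, 2 / ((k : ℝ) + 1) ^ 2 ≤ 4 - 4 / ((n : ℝ) + 1) := by
    induction n with
    | zero => simp
    | succ n ih =>
      rw [Finset.sum_range_succ]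
      have h : 2 / ((n : ℝ) + 1) ^ 2 ≤ 4 / ((n : ℝ) + 1) - 4 / ((n : ℝ) + 1 + 1) := by
        rw [div_sub_div _ _ (by positivity) (by positivity), div_le_div_iff₀ (by positivity)
          (by positivity)]
        have : (0 : ℝ) ≤ n := Nat.cast_nonneg n
        nlinarith [mul_nonneg this this, mul_nonneg this (mul_nonneg this this)]
      push_cast
      linarith
  have : 0 ≤ 4 / ((n : ℝ) + 1) := by positivity
  linarith

end Counts

/-! ### Complexity of the two methods -/

section Complexity

variable {E Y : Type} [NormedAddCommGroup E] [InnerProductSpace ℝ E] [ProperSpace E]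
  [NormedAddCommGroup Y] [InnerProductSpace ℝ Y] [ProperSpace Y]
  {P : CompositeProblem E Y} {L β M Δ ε : ℝ} {x₀ : E}

theorem smoothingParam_pos (hL : 0 < L) (hβ : 0 < β) (hε : 0 < ε) : 0 < smoothingParam L β ε := by
  rw [smoothingParam]
  positivity

/-- The total cost of `k ≤ N` outer steps, each of cost at most `57 (M L / ε) ℓ`. -/
theorem total_cost_le (hL : 1 ≤ L) (hβ : 1 ≤ β) (hΔ : 1 ≤ Δ) (hε : 0 < ε) (hε1 : ε ≤ 1)
    (hM : 0 ≤ M) {ℓ : ℝ} (hℓ : 0 ≤ ℓ) {k : ℕ} (hk : k < ⌈32 * (L * β) * Δ / ε ^ 2⌉₊) {cost : ℝ}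
    (hcost : cost ≤ k * (57 * (M * L / ε * ℓ))) :
    cost ≤ 2000 * (L ^ 2 * β * M * Δ / ε ^ 3 * ℓ) := by
  have hL0 : 0 < L := by linarith
  have hβ0 : 0 < β := by linarith
  have hΔ0 : 0 < Δ := by linarith
  have hkN : (k : ℝ) ≤ 33 * (L * β * Δ / ε ^ 2) :=
    (Nat.cast_le.2 hk.le).trans (outer_count_le hL hβ hΔ hε hε1)
  calc cost ≤ k * (57 * (M * L / ε * ℓ)) := hcost
    _ ≤ 33 * (L * β * Δ / ε ^ 2) * (57 * (M * L / ε * ℓ)) := by gcongr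
    _ = 1881 * (L ^ 2 * β * M * Δ / ε ^ 3 * ℓ) := by
      field_simp
      ring
    _ ≤ 2000 * (L ^ 2 * β * M * Δ / ε ^ 3 * ℓ) := by
      gcongr
      norm_num

theorem dualMethod_complexity (hP : P.Standing L β) (hx₀ : P.g x₀ < ⊤)
    (hF : (Δ : EReal) = P.F x₀ - ⨅ x, P.F x) (hε : 0 < ε) (hM : 10 ≤ M) (hL : 10 ≤ L)
    (hβ : 10 ≤ β) (hΔ : 10 ≤ Δ) (hε1 : ε ≤ 1 / 10) {Mk : ℕ → ℝ} {w₀ : ℕ → Y} {x : ℕ → E}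
    (hx : ∀ k, x k = ((dualMethod L β ε Mk w₀ x₀ k).run P).1)
    (hMk : ∀ k, 0 < Mk k ∧ ‖fderiv ℝ P.c (x k)‖ ≤ Mk k ∧ Mk k ≤ M)
    (hw₀ : ∀ k, fenchelConj (moreau (smoothingParam L β ε) P.h) (w₀ k) < ⊤) :
    (∀ k, (P.smooth (smoothingParam L β ε)).NearStationaryStep (L * β)⁻¹
        (dualTol L (k + 1)) (x k) (x (k + 1))) ∧
      ∃ k, ‖P.proxGrad (L * β)⁻¹ (x k)‖ ≤ ε ∧
        (((dualMethod L β ε Mk w₀ x₀ k).run P).2 : ℝ) ≤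
          2000 * (L ^ 2 * β * M * Δ / ε ^ 3 *
            Real.log (M ^ 2 * L ^ 3 * β * Δ ^ 2 / ε ^ 4)) := by
  have hL0 : 0 < L := by linarith
  have hβ0 : 0 < β := by linarith
  have ht : 0 < (L * β)⁻¹ := by positivity
  have hν := smoothingParam_pos hL0 hβ0 hε
  have hx0 : x 0 = x₀ := by simp [hx, dualMethod]
  have hsucc : ∀ k, x (k + 1) = ((dualStep L (L * β)⁻¹ (smoothingParam L β ε) (dualTol L (k + 1))
      (Mk k) (w₀ k) (x k)).run P).1 := by
    intro k
    rw [hx (k + 1), dualMethod, Prog.run_bind_fst, ← hx k]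
  have hη : ∀ k : ℕ, 0 < dualTol L (k + 1) := by
    intro k
    rw [dualTol]
    positivity
  have hspec := fun k => dualStep_spec hP hL0 ht hν (hη k) (hMk k).1 (hMk k).2.1 (hw₀ k)
  have hg : ∀ k, P.g (x k) < ⊤
    | 0 => hx0 ▸ hx₀
    | k + 1 => hsucc k ▸ (hspec k).2
  have hnear : ∀ k, (P.smooth (smoothingParam L β ε)).NearStationaryStep (L * β)⁻¹
      (dualTol L (k + 1)) (x k) (x (k + 1)) := fun k => hsucc k ▸ (hspec k).1
  have hPν := hP.smooth hL0.le hν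
  obtain ⟨k, hk, hG⟩ := hP.exists_norm_proxGrad_le (by linarith) (by linarith) hε (by linarith)
    (by linarith) hg (hx0 ▸ hF) (e := fun k => 2 / ((k : ℝ) + 1) ^ 2) (fun k => by
      have h1 := hPν.descent hL0 hβ0 (hg k)
        (hPν.modelReal_le_of_nearStationaryStep hL0.le ht (hnear k) (hg (k + 1)))
      -- The dual step decreases by the full `μ/2` multiple; half is discarded to match the descent
      -- condition shared with the primal method.
      have h2 : 0 ≤ L * β / 4 *
        ‖x k - (P.smooth (smoothingParam L β ε)).proxLinear (L * β)⁻¹ (x k)‖ ^ 2 := by positivity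
      have e : 2 * (L * dualTol L (k + 1)) = 2 / ((k : ℝ) + 1) ^ 2 := by
        rw [dualTol]
        push_cast
        field_simp
      linarith) sum_two_div_sq_le
  refine ⟨hnear, k, hG, total_cost_le (by linarith) (by linarith) (by linarith) hε (by linarith)
    (by linarith) ?_ hk ?_⟩
  · refine Real.log_nonneg ?_
    rw [one_le_div (by positivity)]
    calc ε ^ 4 ≤ 1 := pow_le_one₀ hε.le (by linarith)
      _ = 1 ^ 2 * 1 ^ 3 * 1 * 1 ^ 2 := by norm_num
      _ ≤ M ^ 2 * L ^ 3 * β * Δ ^ 2 := by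
        gcongr <;> linarith
  · have hN := outer_count_le (by linarith : 1 ≤ L) (by linarith : 1 ≤ β) (by linarith : 1 ≤ Δ) hε
      (by linarith : ε ≤ 1)
    clear hG
    induction k with
    | zero => simp [dualMethod]
    | succ k ih =>
      have h1 := ih (by omega)
      -- Step `k` uses the tolerance of index `k + 1`, which is still at most the outer count.
      have h2 := dualCount_le hL hβ hΔ hM hε hε1 (hMk k).1 (hMk k).2.2 k.succ_pos
        ((Nat.cast_le.2 hk.le).trans hN)
      rw [dualMethod, Prog.run_bind_snd, dualStep_cost]
      push_cast
      linarith

theorem primalMethod_complexity (hP : P.Standing L β) (hx₀ : P.g x₀ < ⊤)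
    (hF : (Δ : EReal) = P.F x₀ - ⨅ x, P.F x) (hε : 0 < ε) (hM : 10 ≤ M) (hL : 10 ≤ L)
    (hβ : 10 ≤ β) (hΔ : 10 ≤ Δ) (hε1 : ε ≤ 1 / 10) {Mk : ℕ → ℝ} {x : ℕ → E}
    (hx : ∀ k, x k = ((primalMethod Y L β ε Mk x₀ k).run P).1)
    (hMk : ∀ k, 0 < Mk k ∧ ‖fderiv ℝ P.c (x k)‖ ≤ Mk k ∧ Mk k ≤ M) :
    (∀ k, (P.smooth (smoothingParam L β ε)).NearOptimalStep (L * β)⁻¹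
        (L * β / 4 * ‖x k - (P.smooth (smoothingParam L β ε)).proxLinear (L * β)⁻¹ (x k)‖ ^ 2)
        (x k) (x (k + 1))) ∧
      ∃ k, ‖P.proxGrad (L * β)⁻¹ (x k)‖ ≤ ε ∧
        (((primalMethod Y L β ε Mk x₀ k).run P).2 : ℝ) ≤
          2000 * (L ^ 2 * β * M * Δ / ε ^ 3 * Real.log (M * L / ε)) := by
  have hL0 : 0 < L := by linarith
  have hβ0 : 0 < β := by linarith
  have ht : 0 < (L * β)⁻¹ := by positivity
  have hν := smoothingParam_pos hL0 hβ0 hε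
  have hx0 : x 0 = x₀ := by simp [hx, primalMethod]
  have hsucc : ∀ k, x (k + 1) = ((primalStep (Y := Y) (L * β)⁻¹ (smoothingParam L β ε)
      (Mk k) (x k)).run P).1 := by
    intro k
    rw [hx (k + 1), primalMethod, Prog.run_bind_fst, ← hx k]
  have hspec := fun k => primalStep_spec hP hL0 ht hν (hMk k).1 (hMk k).2.1
  have hg : ∀ k, P.g (x k) < ⊤
    | 0 => hx0 ▸ hx₀
    | k + 1 => hsucc k ▸ (hspec k).2
  have hnear : ∀ k, (P.smooth (smoothingParam L β ε)).NearOptimalStep (L * β)⁻¹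
      (L * β / 4 * ‖x k - (P.smooth (smoothingParam L β ε)).proxLinear (L * β)⁻¹ (x k)‖ ^ 2)
      (x k) (x (k + 1)) := by
    intro k
    have := (hspec k).1
    rwa [inv_inv, ← hsucc k] at this
  have hPν := hP.smooth hL0.le hν
  obtain ⟨k, hk, hG⟩ := hP.exists_norm_proxGrad_le (by linarith) (by linarith) hε (by linarith)
    -- The tolerance consumes half of the decrease `μ/2 ‖x - S‖²`, so no additive error remains.
    (by linarith) hg (hx0 ▸ hF) (e := fun _ => 0) (fun k => by
      set S := (P.smooth (smoothingParam L β ε)).proxLinear (L * β)⁻¹ (x k) with hS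
      have h0 := hnear k S
      simp only [CompositeProblem.model] at h0
      rw [add_assoc, ← EReal.coe_add] at h0
      have h1 := (hP.g_pcc.toReal_add_le_iff (hg (k + 1)) (hPν.proxLinear_spec ht (x k)).2.1 _ _).1
        h0
      have h2 := hPν.descent (e := L * β / 4 * ‖x k - S‖ ^ 2) (xp := x (k + 1)) hL0 hβ0 (hg k) (by
        simp only [CompositeProblem.modelReal]
        rw [add_assoc]
        exact h1)
      rw [← hS] at h2
      linarith) (fun n => by simp)
  refine ⟨hnear, k, hG, total_cost_le (by linarith) (by linarith) (by linarith) hε (by linarith)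
    (by linarith) ?_ hk ?_⟩
  · refine Real.log_nonneg ?_
    rw [one_le_div hε]
    nlinarith
  · clear hG
    induction k with
    | zero => simp [primalMethod]
    | succ k ih =>
      have h1 := ih (by omega)
      have h2 := primalCount_le hL hβ hM hε hε1 (hMk k).1 (hMk k).2.2
      rw [primalMethod, Prog.run_bind_snd, primalStep_cost]
      push_cast
      linarith

end Complexity

/-- Complexity of the smoothing strategy. The constants `K`, `C` are absolute (they depend neither on
the dimensions nor on the problem). `M` is the bound `‖∇c‖` on the Jacobians; it is needed only along the
iterates, and each step may use any bound `Mk k` between `‖∇c(x_k)‖` and `M`. The two conjuncts treat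
the dual and the primal subsolves. The number of basic operations needed to compute the iterate `x k` is
`((program k).run P).2`. -/
theorem mainTheorem2 :
    ∃ K : ℝ, 0 < K ∧ ∃ C : ℝ, 0 < C ∧
      ∀ (d m : ℕ) (P : CompositeProblem (EuclideanSpace ℝ (Fin d)) (EuclideanSpace ℝ (Fin m)))
        (L β M Δ ε : ℝ) (x₀ : EuclideanSpace ℝ (Fin d)),
        P.Standing L β → P.g x₀ < ⊤ → (Δ : EReal) = P.F x₀ - ⨅ x, P.F x → 0 < ε →
        K ≤ M → K ≤ L → K ≤ β → K ≤ Δ → K ≤ 1 / ε →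
        (∀ (Mk : ℕ → ℝ) (w₀ : ℕ → EuclideanSpace ℝ (Fin m)) (x : ℕ → EuclideanSpace ℝ (Fin d)),
          (∀ k, x k = ((dualMethod L β ε Mk w₀ x₀ k).run P).1) →
          (∀ k, 0 < Mk k ∧ ‖fderiv ℝ P.c (x k)‖ ≤ Mk k ∧ Mk k ≤ M) →
          (∀ k, fenchelConj (moreau (smoothingParam L β ε) P.h) (w₀ k) < ⊤) →
          (∀ k, (P.smooth (smoothingParam L β ε)).NearStationaryStep (L * β)⁻¹
            (dualTol L (k + 1)) (x k) (x (k + 1))) ∧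
          ∃ k, ‖P.proxGrad (L * β)⁻¹ (x k)‖ ≤ ε ∧
            (((dualMethod L β ε Mk w₀ x₀ k).run P).2 : ℝ) ≤
              C * (L ^ 2 * β * M * Δ / ε ^ 3 *
                Real.log (M ^ 2 * L ^ 3 * β * Δ ^ 2 / ε ^ 4))) ∧
        (∀ (Mk : ℕ → ℝ) (x : ℕ → EuclideanSpace ℝ (Fin d)),
          (∀ k, x k =
            ((primalMethod (EuclideanSpace ℝ (Fin m)) L β ε Mk x₀ k).run P).1) →
          (∀ k, 0 < Mk k ∧ ‖fderiv ℝ P.c (x k)‖ ≤ Mk k ∧ Mk k ≤ M) →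
          (∀ k, (P.smooth (smoothingParam L β ε)).NearOptimalStep (L * β)⁻¹
            (L * β / 4 * ‖x k - (P.smooth (smoothingParam L β ε)).proxLinear (L * β)⁻¹ (x k)‖ ^ 2)
            (x k) (x (k + 1))) ∧
          ∃ k, ‖P.proxGrad (L * β)⁻¹ (x k)‖ ≤ ε ∧
            (((primalMethod (EuclideanSpace ℝ (Fin m)) L β ε Mk x₀ k).run P).2 : ℝ) ≤
              C * (L ^ 2 * β * M * Δ / ε ^ 3 * Real.log (M * L / ε))) := by
  -- The threshold 10 secures `Δ ≥ 5` and the numerical absorptions in the counts; 2000 rounds up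
  -- `33 · 57`, outer steps times cost per step.
  refine ⟨10, by norm_num, 2000, by norm_num, ?_⟩
  intro d m P L β M Δ ε x₀ hP hx₀ hF hε hM hL hβ hΔ hε1
  have hε10 : ε ≤ 1 / 10 := by
    rw [le_div_iff₀ hε] at hε1
    linarith
  exact ⟨fun _ _ _ hx hMk hw₀ => dualMethod_complexity hP hx₀ hF hε hM hL hβ hΔ hε10 hx hMk hw₀,
    fun _ _ hx hMk => primalMethod_complexity hP hx₀ hF hε hM hL hβ hΔ hε10 hx hMk⟩
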